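/- Let $k\in\mathbb N$ and let $Q$ be a generalized quantifier of type $\langle k\rangle$, i.e. a class of structures $(M,R)$ with $M\neq\emptyset$ and $R\subseteq M^k$; write $Q_M=\{R\subseteq M^k : (M,R)\in Q\}$. Assume that $Q$ is monotone increasing (if $A\subseteq B\subseteq M^k$ and $A\in Q_M$, then $B\in Q_M$) and non-trivial ($\emptyset\notin Q_M$ and $M^k\in Q_M$ for every nonempty set $M$). *Independence logic $\mathrm I(Q)$.* For a vocabulary $\tau$, the formulas of $\mathrm I(Q)[\tau]$ are built from first-order atomic and negated atomic $\tau$-formulas, independence atoms $\bar y\perp_{\bar x}\bar z$ (for finite tuples of variables) and their negations by $\wedge$, $\vee$, $\exists y$, $\forall y$ and $Q\bar x$, where $\bar x$ is a $k$-tuple of distinct variables. All variables of an independence atom are free in it. A team $X$ of $M$ is a set of assignments $s:V\to M$ for a fixed finite set $V$ of variables. Satisfaction $\mathbb M,X\models\varphi$, for teams whose domain $V$ contains the free variables of $\varphi$, is defined as follows: - a first-order atomic or negated atomic formula is satisfied by $X$ iff it is satisfied by every $s\in X$; - $\mathbb M,X\models\bar y\perp_{\bar x}\bar z$ iff for all $s,s'\in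 X$ with $s(\bar x)=s'(\bar x)$ there is $s_0\in X$ with $s_0(\bar x)=s(\bar x)$, $s_0(\bar y)=s(\bar y)$ and $s_0(\bar z)=s'(\bar z)$; the negation of this atom is satisfied by $X$ iff $X=\emptyset$; - $\mathbb M,X\models\varphi\wedge\psi$ iff $\mathbb M,X\models\varphi$ and $\mathbb M,X\models\psi$; - $\mathbb M,X\models\varphi\vee\psi$ iff $X=Y\cup Z$ for some $Y,Z$ with $\mathbb M,Y\models\varphi$ and $\mathbb M,Z\models\psi$; - $\mathbb M,X\models\exists y\,\varphi$ iff $\mathbb M,\{s[f(s)/y]: s\in X\}\models\varphi$ for some $f:X\to M$; - $\mathbb M,X\models\forall y\,\varphi$ iff $\mathbb M,\{s[a/y]: s\in X, a\in M\}\models\varphi$; - $\mathbb M,X\models Q\bar x\,\varphi$ iff $\mathbb M,\{s[\bar a/\bar x]: s\in X, \bar a\in F(s)\}\models\varphi$ for some $F:X\to Q_M$. A sentence $\sigma$ (a formula without free variables) is true in $\mathbb M$ iff $\mathbb M,\{\epsilon\}\models\sigma$, where $\epsilon$ is the empty assignment. *The logic $\mathrm{ESO}(Q)$.* The formulas of $\mathrm{ESO}(Q)[\tau]$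 are built from atomic and negated atomic formulas by conjunction, disjunction, first-order existential and universal quantification, $Q$-quantification, and second-order existential quantification over relations and over functions. The semantics is the usual one, with $\mathbb M,s\models Q\bar x\,\varphi$ iff $\{\bar a\in M^k : \mathbb M,s[\bar a/\bar x]\models\varphi\}\in Q_M$. **Theorem.** For sentences, $\mathrm I(Q)\equiv\mathrm{ESO}(Q)$. That is, for every vocabulary $\tau$: for every sentence $\varphi$ of $\mathrm I(Q)[\tau]$ there is a sentence $\psi$ of $\mathrm{ESO}(Q)[\tau]$ such that $\mathbb M\models\varphi\iff\mathbb M\models\psi$ for every $\tau$-structure $\mathbb M$ (with nonempty universe); and for every sentence $\psi$ of $\mathrm{ESO}(Q)[\tau]$ there is a sentence $\varphi$ of $\mathrm I(Q)[\tau]$ such that $\mathbb M\models\varphi\iff\mathbb M\models\psi$ for every such $\mathbb M$. -/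

import Mathlib

universe u v w

namespace TeamLogic

/-! Vocabularies are Mathlib's first-order languages; the first-order variables are the
natural numbers. -/

/-- Assignments of values in `M` to the variables in the finite set `V`. -/
abbrev Assignment (V : Finset ℕ) (M : Type w) : Type w := {x : ℕ // x ∈ V} → M

/-- A team with domain `V`: a set of assignments with domain `V`. -/
abbrev Team (V : Finset ℕ) (M : Type w) : Type w := Set (Assignment V M)

/-- The assignment `s[a/y]`, with domain `V ∪ {y}`. -/
def Assignment.update {V : Finset ℕ} {M : Type w} (s : Assignment V M) (y : ℕ) (a : M) :
    Assignment (insert y V) M := fun z =>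
  if h : z.1 = y then a else s ⟨z.1, Finset.mem_of_mem_insert_of_ne z.2 h⟩

/-- The assignment `s[a₁,…,a_k / x₁,…,x_k]`, where the variables `x₁,…,x_k` are pairwise
distinct; its domain is `V ∪ {x₁,…,x_k}`. -/
noncomputable def Assignment.updateTuple {V : Finset ℕ} {M : Type w} (s : Assignment V M)
    {k : ℕ} (x : Fin k ↪ ℕ) (a : Fin k → M) :
    Assignment (V ∪ Finset.univ.map x) M := fun z =>
  if h : ∃ i, x i = z.1 then a h.choose
  else s ⟨z.1, (Finset.mem_union.mp z.2).resolve_right fun hz =>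
    h (by simpa using hz)⟩

/-- A generalized quantifier of type `⟨k⟩`: a class of structures `(M, R)` with `R ⊆ M ^ k`.
`Q M` is the collection of the `R` with `(M, R)` in the class. -/
abbrev GenQuantifier (k : ℕ) : Type (w + 1) := (M : Type w) → Set (Set (Fin k → M))

/-- `Q` is monotone increasing. -/
def GenQuantifier.Monotone {k : ℕ} (Q : GenQuantifier.{w} k) : Prop :=
  ∀ (M : Type w) [Nonempty M] (A B : Set (Fin k → M)), A ⊆ B → A ∈ Q M → B ∈ Q M

/-- `Q` is non-trivial: `(M, ∅) ∉ Q` and `(M, M ^ k) ∈ Q` for every (nonempty) universe. -/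
def GenQuantifier.NonTrivial {k : ℕ} (Q : GenQuantifier.{w} k) : Prop :=
  ∀ (M : Type w) [Nonempty M], (∅ : Set (Fin k → M)) ∉ Q M ∧ (Set.univ : Set (Fin k → M)) ∈ Q M

/-- First-order atomic and negated atomic formulas with variables in `V`. -/
inductive Literal (L : FirstOrder.Language.{u, v}) (V : Finset ℕ) : Type (max u v)
  | eq (t₁ t₂ : L.Term {x : ℕ // x ∈ V}) : Literal L V
  | neq (t₁ t₂ : L.Term {x : ℕ // x ∈ V}) : Literal L V
  | rel {n : ℕ} (R : L.Relations n) (t : Fin n → L.Term {x : ℕ // x ∈ V}) : Literal L V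
  | nrel {n : ℕ} (R : L.Relations n) (t : Fin n → L.Term {x : ℕ // x ∈ V}) : Literal L V

/-- Satisfaction of (negated) atomic formulas by a single assignment. -/
def Literal.Sat {L : FirstOrder.Language.{u, v}} {V : Finset ℕ} {M : Type w} [L.Structure M]
    (s : Assignment V M) : Literal L V → Prop
  | .eq t₁ t₂ => t₁.realize s = t₂.realize s
  | .neq t₁ t₂ => t₁.realize s ≠ t₂.realize s
  | .rel R t => FirstOrder.Language.Structure.RelMap R fun i => (t i).realize s
  | .nrel R t => ¬ FirstOrder.Language.Structure.RelMap R fun i => (t i).realize s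

/-! ### Independence logic with a generalized quantifier -/

/-- Formulas of `I(Q)` over the vocabulary `L`, where `Q` is of type `⟨k⟩`, in negation normal
form. The index `V` is the set of variables that are in scope. -/
inductive IFormula (L : FirstOrder.Language.{u, v}) (k : ℕ) : Finset ℕ → Type (max u v)
  | lit {V : Finset ℕ} (l : Literal L V) : IFormula L k V
  /-- The independence atom `y ⊥_x z`. -/
  | indep {V : Finset ℕ} (y x z : List {i : ℕ // i ∈ V}) : IFormula L k V
  /-- The negated independence atom. -/
  | nindep {V : Finset ℕ} (y x z : List {i : ℕ // i ∈ V}) : IFormula L k V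
  | and {V : Finset ℕ} (φ ψ : IFormula L k V) : IFormula L k V
  | or {V : Finset ℕ} (φ ψ : IFormula L k V) : IFormula L k V
  | ex {V : Finset ℕ} (y : ℕ) (φ : IFormula L k (insert y V)) : IFormula L k V
  | all {V : Finset ℕ} (y : ℕ) (φ : IFormula L k (insert y V)) : IFormula L k V
  | quant {V : Finset ℕ} (x : Fin k ↪ ℕ) (φ : IFormula L k (V ∪ Finset.univ.map x)) :
      IFormula L k V

/-- Sentences of `I(Q)`: formulas without free variables. -/
abbrev ISentence (L : FirstOrder.Language.{u, v}) (k : ℕ) : Type (max u v) := IFormula L k ∅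

/-- Team semantics of `I(Q)`. -/
def IFormula.Sat {L : FirstOrder.Language.{u, v}} {k : ℕ} (Q : GenQuantifier.{w} k)
    (M : Type w) [L.Structure M] : {V : Finset ℕ} → IFormula L k V → Team V M → Prop
  | _, .lit l, X => ∀ s ∈ X, l.Sat s
  | _, .indep y x z, X => ∀ s ∈ X, ∀ s' ∈ X, x.map s = x.map s' →
      ∃ s₀ ∈ X, x.map s₀ = x.map s ∧ y.map s₀ = y.map s ∧ z.map s₀ = z.map s'
  | _, .nindep _ _ _, X => X = ∅
  | _, .and φ ψ, X => φ.Sat Q M X ∧ ψ.Sat Q M X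
  | V, .or φ ψ, X => ∃ Y Z : Team V M, X = Y ∪ Z ∧ φ.Sat Q M Y ∧ ψ.Sat Q M Z
  | _, .ex y φ, X => ∃ f : X → M, φ.Sat Q M {s' | ∃ s : X, s' = s.1.update y (f s)}
  | _, .all y φ, X => φ.Sat Q M {s' | ∃ s ∈ X, ∃ a : M, s' = s.update y a}
  | _, .quant x φ, X => ∃ F : X → Set (Fin k → M), (∀ s, F s ∈ Q M) ∧
      φ.Sat Q M {s' | ∃ s : X, ∃ a ∈ F s, s' = s.1.updateTuple x a}

/-- Truth of a sentence of `I(Q)`: satisfaction by the team consisting of the empty assignment. -/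
def ISentence.True {L : FirstOrder.Language.{u, v}} {k : ℕ} (Q : GenQuantifier.{w} k)
    (M : Type w) [L.Structure M] (φ : ISentence L k) : Prop :=
  IFormula.Sat Q M φ {fun x => absurd x.2 (Finset.notMem_empty x.1)}

/-! ### Existential second-order logic with a generalized quantifier -/

/-- A single symbol of arity `n`. -/
inductive Symbol (n : ℕ) : ℕ → Type
  | mk : Symbol n n

/-- The vocabulary with exactly one symbol, a relation symbol of arity `n`. -/
def relVocab (n : ℕ) : FirstOrder.Language.{0, 0} := ⟨fun _ => Empty, Symbol n⟩

/-- The vocabulary with exactly one symbol, a function symbol of arity `n`. -/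
def funVocab (n : ℕ) : FirstOrder.Language.{0, 0} := ⟨Symbol n, fun _ => Empty⟩

/-- The interpretation of the new relation symbol by `R`. -/
@[reducible] def relStructure {n : ℕ} {M : Type w} (R : Set (Fin n → M)) :
    (relVocab n).Structure M where
  funMap f := Empty.elim f
  RelMap {_} S := match S with
    | .mk => fun a => a ∈ R

/-- The interpretation of the new function symbol by `f`. -/
@[reducible] def funStructure {n : ℕ} {M : Type w} (f : (Fin n → M) → M) :
    (funVocab n).Structure M where
  funMap {_} S := match S with
    | .mk => f
  RelMap S := Empty.elim S

/-- Formulas of `ESO(Q)`, where `Q` is of type `⟨k⟩`, over a vocabulary `L` and with free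
first-order variables in `V`. A second-order quantifier binds one additional relation or function
symbol: its scope is a formula over the vocabulary extended by this symbol. -/
inductive ESOFormula (k : ℕ) : FirstOrder.Language.{u, v} → Finset ℕ → Type (max (u + 1) (v + 1))
  | lit {L : FirstOrder.Language.{u, v}} {V : Finset ℕ} (l : Literal L V) : ESOFormula k L V
  | and {L : FirstOrder.Language.{u, v}} {V : Finset ℕ} (φ ψ : ESOFormula k L V) :
      ESOFormula k L V
  | or {L : FirstOrder.Language.{u, v}} {V : Finset ℕ} (φ ψ : ESOFormula k L V) :
      ESOFormula k L V
  | ex {L : FirstOrder.Language.{u, v}} {V : Finset ℕ} (y : ℕ)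
      (φ : ESOFormula k L (insert y V)) : ESOFormula k L V
  | all {L : FirstOrder.Language.{u, v}} {V : Finset ℕ} (y : ℕ)
      (φ : ESOFormula k L (insert y V)) : ESOFormula k L V
  | quant {L : FirstOrder.Language.{u, v}} {V : Finset ℕ} (x : Fin k ↪ ℕ)
      (φ : ESOFormula k L (V ∪ Finset.univ.map x)) : ESOFormula k L V
  | exRel {L : FirstOrder.Language.{u, v}} {V : Finset ℕ} (n : ℕ)
      (φ : ESOFormula k (L.sum (relVocab n)) V) : ESOFormula k L V
  | exFun {L : FirstOrder.Language.{u, v}} {V : Finset ℕ} (n : ℕ)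
      (φ : ESOFormula k (L.sum (funVocab n)) V) : ESOFormula k L V

/-- Sentences of `ESO(Q)` over the vocabulary `L`. -/
abbrev ESOSentence (L : FirstOrder.Language.{u, v}) (k : ℕ) : Type (max (u + 1) (v + 1)) :=
  ESOFormula k L ∅

/-- Tarskian semantics of `ESO(Q)`. -/
def ESOFormula.Sat {k : ℕ} (Q : GenQuantifier.{w} k) (M : Type w) :
    {L : FirstOrder.Language.{u, v}} → {V : Finset ℕ} → ESOFormula k L V →
      L.Structure M → Assignment V M → Prop
  | _, _, .lit l, _, s => l.Sat s
  | _, _, .and φ ψ, 𝔐, s => φ.Sat Q M 𝔐 s ∧ ψ.Sat Q M 𝔐 s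
  | _, _, .or φ ψ, 𝔐, s => φ.Sat Q M 𝔐 s ∨ ψ.Sat Q M 𝔐 s
  | _, _, .ex y φ, 𝔐, s => ∃ a : M, φ.Sat Q M 𝔐 (s.update y a)
  | _, _, .all y φ, 𝔐, s => ∀ a : M, φ.Sat Q M 𝔐 (s.update y a)
  | _, _, .quant x φ, 𝔐, s => {a : Fin k → M | φ.Sat Q M 𝔐 (s.updateTuple x a)} ∈ Q M
  | L, _, .exRel n φ, 𝔐, s => ∃ R : Set (Fin n → M),
      φ.Sat Q M (@FirstOrder.Language.sumStructure L (relVocab n) M 𝔐 (relStructure R)) s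
  | L, _, .exFun n φ, 𝔐, s => ∃ f : (Fin n → M) → M,
      φ.Sat Q M (@FirstOrder.Language.sumStructure L (funVocab n) M 𝔐 (funStructure f)) s

/-- Truth of a sentence of `ESO(Q)` in the structure `M`. -/
def ESOSentence.True {L : FirstOrder.Language.{u, v}} {k : ℕ} (Q : GenQuantifier.{w} k)
    (M : Type w) [𝔐 : L.Structure M] (φ : ESOSentence L k) : Prop :=
  ESOFormula.Sat Q M φ 𝔐 (fun x => absurd x.2 (Finset.notMem_empty x.1))

end TeamLogic

/-! From ESO(Q) to I(Q), on structures with at least two elements. A team can store functions: next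
to the ordinary variables there are, for each function variable, argument variables running freely
through the universe and a value variable holding the function's value at them. `rowTeam V S`
consists of all rows obtained in this way from a set `S` of pairs (values of the ordinary variables,
functions). The functions may vary with the pair, so second-order quantifiers may stand below
first-order ones and no normal form is needed. By the invariant `OrdInj` the ordinary variables
determine the pair. `IDef Q V P` asks for a formula of I(Q) that holds in `rowTeam V S` exactly when
`P` holds at every pair in `S`: team semantics then behaves like Tarskian semantics, pair by pair.

The predicates with this property are closed under the constructors of ESO(Q). A quantifier over
ordinary variables (`IDef.quantLike`) is followed by an independence atom that keeps the chosen set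
from depending on the argument variables. A function quantifier (`IDef.exFun`) becomes universal
quantification of the arguments and existential quantification of the value, with a dependence atom
written as `y ⊥_x y`. A disjunction (`IDef.or`) must not split the rows of one pair, so a fresh
ordinary variable records the chosen disjunct; this needs two elements. A relation is coded as the
set where a function takes a fixed value `c`. Non-triviality makes the chosen sets nonempty, as the
independence atom requires; monotonicity allows a subset of the defined set as witness for `Q`.

On one-element structures all conditions are Boolean, and `exists_iformula_of_subsingleton`
translates them directly. A disjunction over the size of the universe joins the two translations.

From I(Q) to ESO(Q), a team whose domain has `n` variables is coded by an `n`-ary relation. Subteams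
and choice functions become existentially quantified relations (`exists_extension_iff`), and
induction on the formula gives `IFormula.teamDef`. -/

namespace TeamLogic

/-! ### Restrictions of total assignments -/

/-- The restriction of a total assignment to the variables in `V`. -/
def res {M : Type w} (V : Finset ℕ) (t : ℕ → M) : Assignment V M := fun x => t x

/-- The total assignment `s` changed to `a` on the variables `d, …, d + n - 1`. -/
def updN {M : Type w} {n : ℕ} (s : ℕ → M) (d : ℕ) (a : Fin n → M) : ℕ → M := fun i =>
  if h : d ≤ i ∧ i < d + n then a ⟨i - d, by omega⟩ else s i

@[simp] lemma res_apply {M : Type w} (V : Finset ℕ) (t : ℕ → M) (x : {x : ℕ // x ∈ V}) :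
    res V t x = t x := rfl

lemma updN_add {M : Type w} {n : ℕ} (s : ℕ → M) (d : ℕ) (a : Fin n → M) (j : Fin n) :
    updN s d a (d + j) = a j := by
  have := j.2
  simp [updN]

lemma updN_of_lt {M : Type w} {n : ℕ} (s : ℕ → M) (d : ℕ) (a : Fin n → M) {i : ℕ} (h : i < d) :
    updN s d a i = s i := by
  simp [updN, Nat.not_le.2 h]

lemma updN_of_ne {M : Type w} {n : ℕ} (s : ℕ → M) (d : ℕ) (a : Fin n → M) {i : ℕ}
    (h : ∀ j : Fin n, i ≠ d + j) : updN s d a i = s i := by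
  unfold updN
  split_ifs with h'
  · exact absurd (by simp; omega) (h ⟨i - d, by omega⟩)
  · rfl

lemma updN_one {M : Type w} (s : ℕ → M) (d : ℕ) (a : Fin 1 → M) :
    updN s d a = Function.update s d (a 0) := by
  funext i
  by_cases h : i = d
  · subst h; simpa using updN_add s i a 0
  · rw [Function.update_of_ne h, updN_of_ne]
    intro j; simpa [Fin.fin_one_eq_zero j] using h

lemma updN_zero {M : Type w} (s : ℕ → M) (d : ℕ) (a : Fin 0 → M) : updN s d a = s :=
  funext fun _ => updN_of_ne s d a fun j => j.elim0

lemma updN_succ {M : Type w} {n : ℕ} (s : ℕ → M) (d : ℕ) (a : Fin (n + 1) → M) :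
    updN s d a = Function.update (updN s d (fun j : Fin n => a j.castSucc)) (d + n)
      (a (Fin.last n)) := by
  funext i
  by_cases h : i = d + n
  · subst h; simpa using updN_add s d a (Fin.last n)
  · rw [Function.update_of_ne h]
    unfold updN
    by_cases h1 : d ≤ i ∧ i < d + n
    · rw [dif_pos h1, dif_pos (by omega)]; rfl
    · rw [dif_neg h1, dif_neg (by omega)]

lemma res_update {M : Type w} (V : Finset ℕ) (t : ℕ → M) (y : ℕ) (a : M) :
    (res V t).update y a = res (insert y V) (Function.update t y a) := by
  funext x
  by_cases h : x.1 = y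
  · simp [Assignment.update, res, h]
  · simp [Assignment.update, res, h]

lemma res_updateTuple {M : Type w} (V : Finset ℕ) {k : ℕ} (x : Fin k ↪ ℕ) (t t' : ℕ → M)
    (a : Fin k → M) (h : ∀ j, t' (x j) = a j) (h' : ∀ z, (∀ j, x j ≠ z) → t' z = t z) :
    (res V t).updateTuple x a = res (V ∪ Finset.univ.map x) t' := by
  funext z
  by_cases hz : ∃ j, x j = z.1
  · have := h hz.choose
    rw [hz.choose_spec] at this
    simp only [Assignment.updateTuple, res, dif_pos hz, this]
  · simp only [Assignment.updateTuple, res, dif_neg hz]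
    exact (h' _ fun j hj => hz ⟨j, hj⟩).symm

lemma eq_res_of_isEmpty {M : Type w} (s : Assignment ∅ M) (t : ℕ → M) : s = res ∅ t :=
  funext fun x => absurd x.2 (Finset.notMem_empty x.1)

/-! ### Teams carrying functions -/

/-- Names of the variables: ordinary variables, argument variables (the `j`-th argument of the
`i`-th function of arity `n`) and value variables (the value of this function). -/
abbrev VarName : Type := ℕ ⊕ (ℕ × ℕ × ℕ) ⊕ (ℕ × ℕ)

/-- The `i`-th ordinary variable. -/
def ordVar (i : ℕ) : ℕ := Denumerable.eqv VarName (.inl i)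

/-- The `j`-th argument variable of the `i`-th function of arity `n`. -/
def argVar (i n j : ℕ) : ℕ := Denumerable.eqv VarName (.inr (.inl (i, n, j)))

/-- The value variable of the `i`-th function of arity `n`. -/
def valVar (i n : ℕ) : ℕ := Denumerable.eqv VarName (.inr (.inr (i, n)))

lemma ordVar_inj {i j : ℕ} : ordVar i = ordVar j ↔ i = j := by simp [ordVar]

lemma valVar_inj {i j n m : ℕ} : valVar i n = valVar j m ↔ i = j ∧ n = m := by simp [valVar]

lemma argVar_inj {i j n m a b : ℕ} : argVar i n a = argVar j m b ↔ i = j ∧ n = m ∧ a = b := by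
  simp [argVar]

lemma ordVar_ne_argVar {i j n a : ℕ} : ordVar i ≠ argVar j n a := by simp [ordVar, argVar]

lemma ordVar_ne_valVar {i j n : ℕ} : ordVar i ≠ valVar j n := by simp [ordVar, valVar]

lemma valVar_ne_argVar {i j n m a : ℕ} : valVar i m ≠ argVar j n a := by simp [valVar, argVar]

lemma var_cases (x : ℕ) : (∃ i, x = ordVar i) ∨ (∃ i n j, x = argVar i n j) ∨
    ∃ i n, x = valVar i n := by
  obtain ⟨y, rfl⟩ := (Denumerable.eqv VarName).surjective x
  rcases y with i | ⟨i, n, j⟩ | ⟨i, n⟩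
  · exact .inl ⟨i, rfl⟩
  · exact .inr (.inl ⟨i, n, j, rfl⟩)
  · exact .inr (.inr ⟨i, n, rfl⟩)

/-- Values of function variables. -/
abbrev FunEnv (M : Type w) : Type w := ℕ → (n : ℕ) → (Fin n → M) → M

/-- The total assignment with values `s` of the ordinary variables and `u` of the argument
variables, in which the value variables have the values given by the functions `f`. -/
def row {M : Type w} (s : ℕ → M) (f : FunEnv M) (u : ℕ → ℕ → ℕ → M) (x : ℕ) : M :=
  match (Denumerable.eqv VarName).symm x with
  | .inl i => s i
  | .inr (.inl (i, n, j)) => u i n j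
  | .inr (.inr (i, n)) => f i n fun j => u i n j

section row
variable {M : Type w} (s : ℕ → M) (f : FunEnv M) (u : ℕ → ℕ → ℕ → M)

@[simp] lemma row_ordVar (i : ℕ) : row s f u (ordVar i) = s i := by simp [row, ordVar]

@[simp] lemma row_argVar (i n j : ℕ) : row s f u (argVar i n j) = u i n j := by
  simp [row, argVar]

@[simp] lemma row_valVar (i n : ℕ) : row s f u (valVar i n) = f i n fun j => u i n j := by
  simp [row, valVar]

lemma update_row_ordVar (d : ℕ) (a : M) :
    Function.update (row s f u) (ordVar d) a = row (Function.update s d a) f u := by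
  funext x
  rcases var_cases x with ⟨i, rfl⟩ | ⟨i, n, j, rfl⟩ | ⟨i, n, rfl⟩
  · by_cases h : i = d
    · subst h; simp
    · rw [Function.update_of_ne (by simpa [ordVar_inj] using h)]; simp [h]
  · rw [Function.update_of_ne ordVar_ne_argVar.symm]; simp
  · rw [Function.update_of_ne ordVar_ne_valVar.symm]; simp

end row

/-- A set of variables containing the arguments of all its value variables. -/
def ArgClosed (V : Finset ℕ) : Prop :=
  ∀ i n, valVar i n ∈ V → ∀ j : Fin n, argVar i n j ∈ V

/-- The pairs in `S` are determined by the values of the ordinary variables in `V`. -/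
def OrdInj {M : Type w} (V : Finset ℕ) (S : Set ((ℕ → M) × FunEnv M)) : Prop :=
  ∀ p ∈ S, ∀ q ∈ S, (∀ i, ordVar i ∈ V → p.1 i = q.1 i) → p = q

/-- The team of all rows given by the elements of `S`. -/
def rowTeam {M : Type w} (V : Finset ℕ) (S : Set ((ℕ → M) × FunEnv M)) : Team V M :=
  {r | ∃ p ∈ S, ∃ u, r = res V (row p.1 p.2 u)}

lemma res_eq_iff {M : Type w} {V : Finset ℕ} {t t' : ℕ → M} :
    res V t = res V t' ↔ ∀ x ∈ V, t x = t' x := by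
  simp [res, funext_iff]

/-- The value variables need no hypothesis of their own: each one in `V` has all its arguments in
`V`. -/
lemma res_row_eq {M : Type w} {V : Finset ℕ} (hV : ArgClosed V) {s s' : ℕ → M} {f : FunEnv M}
    {u u' : ℕ → ℕ → ℕ → M} (hs : ∀ i, ordVar i ∈ V → s i = s' i)
    (hu : ∀ i n j, argVar i n j ∈ V → u i n j = u' i n j) :
    res V (row s f u) = res V (row s' f u') := by
  rw [res_eq_iff]
  intro x hx
  rcases var_cases x with ⟨i, rfl⟩ | ⟨i, n, j, rfl⟩ | ⟨i, n, rfl⟩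
  · simpa using hs i hx
  · simpa using hu i n j hx
  · simp only [row_valVar]
    exact congrArg _ (funext fun j => hu i n j (hV i n hx j))

/-- A row remembers the pair it comes from, so a choice made for each pair is also a choice for each
row. -/
lemma OrdInj.eq_of_row {M : Type w} {V : Finset ℕ} {S : Set ((ℕ → M) × FunEnv M)}
    (hS : OrdInj V S) {p q : (ℕ → M) × FunEnv M} (hp : p ∈ S) (hq : q ∈ S)
    {u u' : ℕ → ℕ → ℕ → M} (h : res V (row p.1 p.2 u) = res V (row q.1 q.2 u')) : p = q := by
  refine hS p hp q hq fun i hi => ?_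
  simpa using res_eq_iff.1 h _ hi

open Classical in
/-- The list of the variables in `V` with the property `p`. -/
noncomputable def sel (V : Finset ℕ) (p : ℕ → Prop) : List {i : ℕ // i ∈ V} :=
  V.attach.toList.filter fun x => p x.1

lemma sel_map_eq {M : Type w} {V : Finset ℕ} {p : ℕ → Prop} {t t' : ℕ → M} :
    (sel V p).map (res V t) = (sel V p).map (res V t') ↔ ∀ x ∈ V, p x → t x = t' x := by
  simp [sel, List.map_inj_left, res]

/-- Predicates of structures, functions and values of the ordinary variables. -/
abbrev RowPred (L : FirstOrder.Language.{u, v}) : Type (max u v (w + 1)) :=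
  (M : Type w) → L.Structure M → FunEnv M → (ℕ → M) → Prop

/-- `P` is expressed by a formula of `I(Q)` on teams of rows. -/
def IDef {L : FirstOrder.Language.{u, v}} {k : ℕ} (Q : GenQuantifier.{w} k) (V : Finset ℕ)
    (P : RowPred.{u, v, w} L) : Prop :=
  ∃ φ : IFormula L k V, ∀ (M : Type w) [Nontrivial M] (𝔐 : L.Structure M)
    (S : Set ((ℕ → M) × FunEnv M)), OrdInj V S →
    (φ.Sat Q M (rowTeam V S) ↔ ∀ p ∈ S, P M 𝔐 p.2 p.1)

/-! ### Quantifiers over ordinary variables on row teams -/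

section IDef
variable {L : FirstOrder.Language.{u, v}} {k : ℕ} {Q : GenQuantifier.{w} k} {V V' : Finset ℕ}
  {P P' : RowPred.{u, v, w} L}

lemma IDef.congr (h : IDef Q V P)
    (hP : ∀ (M : Type w) [Nontrivial M] 𝔐 f s, P M 𝔐 f s ↔ P' M 𝔐 f s) : IDef Q V P' := by
  obtain ⟨φ, hφ⟩ := h
  exact ⟨φ, fun M _ 𝔐 S hS => by simp only [hφ M 𝔐 S hS, hP]⟩

lemma IDef.and (h : IDef Q V P) (h' : IDef Q V P') :
    IDef Q V fun M 𝔐 f s => P M 𝔐 f s ∧ P' M 𝔐 f s := by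
  obtain ⟨φ, hφ⟩ := h
  obtain ⟨φ', hφ'⟩ := h'
  refine ⟨φ.and φ', fun M _ 𝔐 S hS => ?_⟩
  simp only [IFormula.Sat, hφ M 𝔐 S hS, hφ' M 𝔐 S hS]
  exact ⟨fun h p hp => ⟨h.1 p hp, h.2 p hp⟩, fun h => ⟨fun p hp => (h p hp).1,
    fun p hp => (h p hp).2⟩⟩

/-- Quantification of ordinary variables. -/
lemma IDef.quantLike {m d : ℕ} (hV : ArgClosed V)
    (con : IFormula L k V' → IFormula L k V) (C : (M : Type w) → Set (Set (Fin m → M)))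
    (upd : (M : Type w) → Assignment V M → (Fin m → M) → Assignment V' M)
    (hcon : ∀ (M : Type w) [Nontrivial M] (_ : L.Structure M) (φ : IFormula L k V')
      (X : Team V M), (con φ).Sat Q M X ↔ ∃ F : X → Set (Fin m → M), (∀ s, F s ∈ C M) ∧
        φ.Sat Q M {s' | ∃ s : X, ∃ a ∈ F s, s' = upd M s a})
    (hupd : ∀ (M : Type w) (s : ℕ → M) f u a,
      upd M (res V (row s f u)) a = res V' (row (updN s d a) f u))
    (hV' : ∀ x, x ∈ V' ↔ x ∈ V ∨ ∃ j : Fin m, x = ordVar (d + j))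
    (hd : ∀ j : Fin m, ordVar (d + j) ∉ V)
    (hC : ∀ (M : Type w) [Nontrivial M], ∀ A ∈ C M, A.Nonempty)
    (h : IDef Q V' P) :
    IDef Q V fun M 𝔐 f s => ∃ A ∈ C M, ∀ a ∈ A, P M 𝔐 f (updN s d a) := by
  obtain ⟨φ, hφ⟩ := h
  have hVo : ∀ {M : Type w} (s : ℕ → M) (a : Fin m → M) (i : ℕ), ordVar i ∈ V →
      updN s d a i = s i := by
    intro M s a i hi
    refine updN_of_ne s d a fun j hj => hd j ?_
    rwa [hj] at hi
  have hsub : ∀ x ∈ V, x ∈ V' := fun x hx => (hV' x).2 (.inl hx)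
  -- The atom says: given the old ordinary variables, the new ones are independent of all argument
  -- variables.
  refine ⟨con (.and (.indep (sel V' fun x => ∃ j : Fin m, x = ordVar (d + j))
    (sel V' fun x => x ∈ V ∧ ∃ i, x = ordVar i)
    (sel V' fun x => ∃ i n j, x = argVar i n j)) φ), fun M _ 𝔐 S hS => ?_⟩
  -- If the chosen set depends only on the pair, the extended team is again a row team.
  have key : ∀ (F : rowTeam V S → Set (Fin m → M)) (A : S → Set (Fin m → M)),
      (∀ (p : S) u h, F ⟨res V (row p.1.1 p.1.2 u), h⟩ = A p) →
      {s' | ∃ s : rowTeam V S, ∃ a ∈ F s, s' = upd M s a} =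
        rowTeam V' {q | ∃ p : S, ∃ a ∈ A p, q = (updN p.1.1 d a, p.1.2)} := by
    intro F A hFA
    ext s'
    constructor
    · rintro ⟨⟨_, p, hp, u, rfl⟩, a, ha, rfl⟩
      exact ⟨_, ⟨⟨p, hp⟩, a, (hFA ⟨p, hp⟩ u ⟨p, hp, u, rfl⟩).subset ha, rfl⟩, u,
        hupd M _ _ _ _⟩
    · rintro ⟨_, ⟨p, a, ha, rfl⟩, u, rfl⟩
      exact ⟨⟨_, p.1, p.2, u, rfl⟩, a, (hFA p u ⟨p.1, p.2, u, rfl⟩).symm.subset ha,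
        (hupd M _ _ _ _).symm⟩
  have inj : ∀ A : S → Set (Fin m → M),
      OrdInj V' {q | ∃ p : S, ∃ a ∈ A p, q = (updN p.1.1 d a, p.1.2)} := by
    rintro A _ ⟨p, a, -, rfl⟩ _ ⟨q, b, -, rfl⟩ hpq
    have : p = q := by
      refine Subtype.ext (hS _ p.2 _ q.2 fun i hi => ?_)
      simpa only [hVo _ _ i hi] using hpq i (hsub _ hi)
    subst this
    have : a = b := by
      funext j
      simpa only [updN_add] using hpq (d + j) ((hV' _).2 (.inr ⟨j, rfl⟩))
    rw [this]
  rw [hcon]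
  constructor
  · rintro ⟨F, hF, hind, hsat⟩ p hp
    let u₀ : ℕ → ℕ → ℕ → M := fun _ _ _ => p.1 0
    have hmem : ∀ (p : S) u, res V (row p.1.1 p.1.2 u) ∈ rowTeam V S :=
      fun p u => ⟨p.1, p.2, u, rfl⟩
    -- The tuple `b` only serves to put a row with arguments `u'` into the extended team. The atom
    -- combines the `a` of the first row with the arguments of the second, so `a` was also chosen at
    -- `u'`.
    have hle : ∀ (p : S) u u', F ⟨_, hmem p u⟩ ⊆ F ⟨_, hmem p u'⟩ := by
      intro p u u' a ha
      obtain ⟨b, hb⟩ := hC M _ (hF ⟨_, hmem p u'⟩)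
      obtain ⟨_, ⟨⟨_, q, hq, u₁, rfl⟩, c, hc, rfl⟩, h1, h2, h3⟩ :=
        hind _ ⟨⟨_, hmem p u⟩, a, ha, rfl⟩ _ ⟨⟨_, hmem p u'⟩, b, hb, rfl⟩ (by
          simp only [hupd]
          rw [sel_map_eq]
          rintro _ - ⟨hi, i, rfl⟩
          simp [hVo _ _ i hi])
      simp only [hupd] at h1 h2 h3
      rw [sel_map_eq] at h1 h2 h3
      obtain rfl : q = p.1 := by
        refine hS q hq p.1 p.2 fun i hi => ?_
        simpa [hVo _ _ i hi] using h1 _ (hsub _ hi) ⟨hi, i, rfl⟩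
      have hca : c = a := by
        funext j
        simpa [updN_add] using h2 _ ((hV' _).2 (.inr ⟨j, rfl⟩)) ⟨j, rfl⟩
      have hu : res V (row p.1.1 p.1.2 u₁) = res V (row p.1.1 p.1.2 u') := by
        refine res_row_eq hV (fun _ _ => rfl) fun i n j hi => ?_
        simpa using h3 _ (hsub _ hi) ⟨i, n, j, rfl⟩
      subst hca
      simpa only [hu] using hc
    let A : S → Set (Fin m → M) := fun q => F ⟨_, hmem q u₀⟩
    rw [key F A fun q u _ => (hle q u u₀).antisymm (hle q u₀ u), hφ M 𝔐 _ (inj A)] at hsat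
    exact ⟨A ⟨p, hp⟩, hF _, fun a ha => hsat _ ⟨⟨p, hp⟩, a, ha, rfl⟩⟩
  · intro hP
    choose! A' hA hAP using hP
    let A : S → Set (Fin m → M) := fun p => A' p.1
    -- `r.2.choose` is the pair of the row `r`; by `OrdInj` there is no other.
    have hkey := key (fun r => A' r.2.choose) A (by
      intro p u h
      have := h.choose_spec
      obtain ⟨hq, u', hu'⟩ := this
      exact congrArg A' (hS.eq_of_row hq p.2 hu'.symm))
    refine ⟨fun r => A' r.2.choose, fun r => hA _ r.2.choose_spec.1, ?_⟩
    rw [hkey]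
    refine ⟨?_, ?_⟩
    · rintro _ ⟨_, ⟨p, a, ha, rfl⟩, u, rfl⟩ _ ⟨_, ⟨q, b, hb, rfl⟩, u', rfl⟩ hpq
      rw [sel_map_eq] at hpq
      obtain rfl : p = q := by
        refine Subtype.ext (hS _ p.2 _ q.2 fun i hi => ?_)
        simpa [hVo _ _ i hi] using hpq _ (hsub _ hi) ⟨hi, i, rfl⟩
      refine ⟨_, ⟨_, ⟨p, a, ha, rfl⟩, u', rfl⟩, ?_⟩
      simp only [sel_map_eq]
      refine ⟨?_, ?_, ?_⟩
      · rintro _ - ⟨-, i, rfl⟩; simp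
      · rintro _ - ⟨i, rfl⟩; simp
      · rintro _ - ⟨i, n, j, rfl⟩; simp
    · rw [hφ M 𝔐 _ (inj A)]
      rintro _ ⟨p, a, ha, rfl⟩
      exact hAP _ p.2 a ha

end IDef

/-! ### Connectives, literals and function quantifiers on row teams -/

section IDef
variable {L : FirstOrder.Language.{u, v}} {k : ℕ} {Q : GenQuantifier.{w} k} {V V' : Finset ℕ}
  {P P' : RowPred.{u, v, w} L}

lemma ArgClosed.insert_ordVar (hV : ArgClosed V) (d : ℕ) : ArgClosed (insert (ordVar d) V) := by
  intro i n hi j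
  rcases Finset.mem_insert.1 hi with hi | hi
  · exact absurd hi.symm ordVar_ne_valVar
  · exact Finset.mem_insert_of_mem (hV i n hi j)

/-- The tuple of the ordinary variables `d, …, d + n - 1`. -/
def ordTuple (n d : ℕ) : Fin n ↪ ℕ := ⟨fun j => ordVar (d + j), fun i j h => by
  simpa [ordVar_inj, Fin.ext_iff] using h⟩

@[simp] lemma ordTuple_apply (n d : ℕ) (j : Fin n) : ordTuple n d j = ordVar (d + j) := rfl

/-- `V` together with the ordinary variables `d, …, d + n - 1`. -/
abbrev addOrd (V : Finset ℕ) (n d : ℕ) : Finset ℕ := V ∪ Finset.univ.map (ordTuple n d)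

lemma mem_addOrd {n d x : ℕ} : x ∈ addOrd V n d ↔ x ∈ V ∨ ∃ j : Fin n, x = ordVar (d + j) := by
  simp [eq_comm]

lemma addOrd_zero (d : ℕ) : addOrd V 0 d = V := by
  simp [addOrd]

lemma addOrd_succ (n d : ℕ) : addOrd V (n + 1) d = insert (ordVar (d + n)) (addOrd V n d) := by
  ext x
  rw [mem_addOrd, Finset.mem_insert, mem_addOrd]
  constructor
  · rintro (h | ⟨j, rfl⟩)
    · exact .inr (.inl h)
    · rcases Fin.eq_castSucc_or_eq_last j with ⟨j, rfl⟩ | rfl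
      · exact .inr (.inr ⟨j, rfl⟩)
      · exact .inl rfl
  · rintro (rfl | h | ⟨j, rfl⟩)
    exacts [.inr ⟨Fin.last n, rfl⟩, .inl h, .inr ⟨j.castSucc, rfl⟩]

lemma ArgClosed.addOrd (hV : ArgClosed V) (n d : ℕ) : ArgClosed (addOrd V n d) := by
  induction n with
  | zero => rwa [addOrd_zero]
  | succ n ih => rw [addOrd_succ]; exact ih.insert_ordVar _

/-- For `∃` the sets that may be chosen are the singletons, for `∀` only the full set; both are
nonempty, so `IDef.quantLike` applies. -/
lemma IDef.ex {d : ℕ} (hV : ArgClosed V) (hd : ordVar d ∉ V)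
    (h : IDef Q (insert (ordVar d) V) P) :
    IDef Q V fun M 𝔐 f s => ∃ a, P M 𝔐 f (Function.update s d a) := by
  refine (IDef.quantLike (m := 1) (d := d) hV (.ex (ordVar d)) (fun M => {A | ∃ a, A = {a}})
    (fun M s a => s.update (ordVar d) (a 0)) ?_ ?_ ?_ ?_ ?_ h).congr ?_
  · intro M _ _ φ X
    constructor
    · rintro ⟨f, hf⟩
      refine ⟨fun s => {fun _ => f s}, fun s => ⟨_, rfl⟩, ?_⟩
      simpa using hf
    · rintro ⟨F, hF, h⟩
      choose a ha using hF
      refine ⟨fun s => a s 0, ?_⟩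
      simpa [ha] using h
  · intro M s f u a
    rw [res_update, update_row_ordVar, updN_one]
  · intro x
    rw [Finset.mem_insert]
    simp [or_comm]
  · simpa using hd
  · rintro M _ _ ⟨a, rfl⟩
    exact Set.singleton_nonempty a
  · intro M _ 𝔐 f s
    constructor
    · rintro ⟨_, ⟨a, rfl⟩, h⟩
      exact ⟨a 0, by simpa [updN_one] using h a rfl⟩
    · rintro ⟨a, h⟩
      exact ⟨{fun _ => a}, ⟨_, rfl⟩, by simpa [updN_one] using h⟩

lemma IDef.all {d : ℕ} (hV : ArgClosed V) (hd : ordVar d ∉ V)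
    (h : IDef Q (insert (ordVar d) V) P) :
    IDef Q V fun M 𝔐 f s => ∀ a, P M 𝔐 f (Function.update s d a) := by
  refine (IDef.quantLike (m := 1) (d := d) hV (.all (ordVar d)) (fun M => {Set.univ})
    (fun M s a => s.update (ordVar d) (a 0)) ?_ ?_ ?_ ?_ ?_ h).congr ?_
  · intro M _ _ φ X
    have : {s' | ∃ s ∈ X, ∃ a : M, s' = s.update (ordVar d) a} =
        {s' | ∃ s : X, ∃ a ∈ (Set.univ : Set (Fin 1 → M)),
          s' = s.1.update (ordVar d) (a 0)} := by
      ext s'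
      constructor
      · rintro ⟨s, hs, a, rfl⟩
        exact ⟨⟨s, hs⟩, fun _ => a, trivial, rfl⟩
      · rintro ⟨s, a, -, rfl⟩
        exact ⟨s, s.2, a 0, rfl⟩
    simp only [IFormula.Sat, this]
    constructor
    · exact fun h => ⟨fun _ => Set.univ, fun _ => rfl, h⟩
    · rintro ⟨F, hF, h⟩
      obtain rfl : F = fun _ => Set.univ := funext hF
      exact h
  · intro M s f u a
    rw [res_update, update_row_ordVar, updN_one]
  · intro x
    rw [Finset.mem_insert]
    simp [or_comm]
  · simpa using hd
  · rintro M _ _ rfl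
    exact Set.univ_nonempty
  · intro M _ 𝔐 f s
    constructor
    · rintro ⟨_, rfl, h⟩ a
      simpa [updN_one] using h (fun _ => a) trivial
    · intro h
      exact ⟨Set.univ, rfl, fun a _ => by simpa [updN_one] using h (a 0)⟩

/-- Members of `Q M` are nonempty by non-triviality. A member on which `P` holds is contained in the
set defined by `P`, which is then a member by monotonicity. -/
lemma IDef.quant (hmono : Q.Monotone) (hnontriv : Q.NonTrivial) {d : ℕ} (hV : ArgClosed V)
    (hd : ∀ j : Fin k, ordVar (d + j) ∉ V) (h : IDef Q (addOrd V k d) P) :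
    IDef Q V fun M 𝔐 f s => {a | P M 𝔐 f (updN s d a)} ∈ Q M := by
  refine (IDef.quantLike (m := k) (d := d) hV (.quant (ordTuple k d)) (fun M => Q M)
    (fun M s a => s.updateTuple (ordTuple k d) a) (fun _ _ _ _ _ => Iff.rfl) ?_
    (fun _ => mem_addOrd) hd ?_ h).congr ?_
  · intro M s f u a
    refine res_updateTuple _ _ _ _ _ (fun j => by simp [updN_add]) fun z hz => ?_
    rcases var_cases z with ⟨i, rfl⟩ | ⟨i, n, j, rfl⟩ | ⟨i, n, rfl⟩
    · simp only [row_ordVar]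
      exact updN_of_ne _ _ _ fun j hj => hz j (by rw [hj]; rfl)
    · simp
    · simp
  · intro M _ A hA
    rw [Set.nonempty_iff_ne_empty]
    rintro rfl
    exact (hnontriv M).1 hA
  · intro M _ 𝔐 f s
    constructor
    · rintro ⟨A, hA, h⟩
      exact hmono M A _ h hA
    · exact fun h => ⟨_, h, fun a ha => ha⟩

lemma IDef.exTuple {n d : ℕ} (hV : ArgClosed V) (hd : ∀ i, ordVar i ∈ V → i < d)
    (h : IDef Q (addOrd V n d) P) :
    IDef Q V fun M 𝔐 f s => ∃ a : Fin n → M, P M 𝔐 f (updN s d a) := by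
  induction n generalizing P with
  | zero =>
    rw [addOrd_zero] at h
    exact h.congr fun M _ 𝔐 f s => by simp [updN_zero]
  | succ n ih =>
    rw [addOrd_succ] at h
    have hn : ordVar (d + n) ∉ addOrd V n d := by
      rw [mem_addOrd]
      rintro (h | ⟨j, hj⟩)
      · exact absurd (hd _ h) (by omega)
      · have := ordVar_inj.1 hj; omega
    refine (ih (h.ex (hV.addOrd n d) hn)).congr fun M _ 𝔐 f s => ?_
    constructor
    · rintro ⟨a, b, h⟩
      refine ⟨Fin.snoc (α := fun _ => M) a b, ?_⟩
      rw [updN_succ]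
      simpa using h
    · rintro ⟨a, h⟩
      rw [updN_succ] at h
      exact ⟨_, _, h⟩

lemma IDef.lit (l : Literal L V)
    (h : ∀ (M : Type w) (𝔐 : L.Structure M) f s u, l.Sat (res V (row s f u)) ↔ P M 𝔐 f s) :
    IDef Q V P := by
  refine ⟨.lit l, fun M _ 𝔐 S _ => ?_⟩
  simp only [IFormula.Sat]
  constructor
  · intro hl p hp
    exact (h M 𝔐 p.2 p.1 fun _ _ _ => p.1 0).1 (hl _ ⟨p, hp, _, rfl⟩)
  · rintro hP _ ⟨p, hp, u, rfl⟩
    exact (h M 𝔐 p.2 p.1 u).2 (hP p hp)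

/-- The term consisting of a variable. -/
abbrev varT {x : ℕ} (hx : x ∈ V) : L.Term {x : ℕ // x ∈ V} := .var ⟨x, hx⟩

lemma IDef.eq {i j : ℕ} (hi : ordVar i ∈ V) (hj : ordVar j ∈ V) :
    IDef (L := L) Q V fun _ _ _ s => s i = s j :=
  .lit (.eq (varT hi) (varT hj)) fun M _ f s u => by
    simp [Literal.Sat]

lemma IDef.neq {i j : ℕ} (hi : ordVar i ∈ V) (hj : ordVar j ∈ V) :
    IDef (L := L) Q V fun _ _ _ s => s i ≠ s j :=
  .lit (.neq (varT hi) (varT hj)) fun M _ f s u => by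
    simp [Literal.Sat]

lemma IDef.rel {n : ℕ} (R : L.Relations n) {z : Fin n → ℕ} (hz : ∀ j, ordVar (z j) ∈ V) :
    IDef (L := L) Q V fun _ 𝔐 _ s => 𝔐.RelMap R fun j => s (z j) :=
  .lit (.rel R fun j => varT (hz j)) fun M _ f s u => by
    simp [Literal.Sat]

lemma IDef.nrel {n : ℕ} (R : L.Relations n) {z : Fin n → ℕ} (hz : ∀ j, ordVar (z j) ∈ V) :
    IDef (L := L) Q V fun _ 𝔐 _ s => ¬ 𝔐.RelMap R fun j => s (z j) :=
  .lit (.nrel R fun j => varT (hz j)) fun M _ f s u => by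
    simp [Literal.Sat]

lemma IDef.func {n i : ℕ} (g : L.Functions n) {z : Fin n → ℕ} (hz : ∀ j, ordVar (z j) ∈ V)
    (hi : ordVar i ∈ V) :
    IDef (L := L) Q V fun _ 𝔐 _ s => 𝔐.funMap g (fun j => s (z j)) = s i :=
  .lit (.eq (.func g fun j => varT (hz j)) (varT hi)) fun M _ f s u => by
    simp [Literal.Sat, FirstOrder.Language.Term.realize]

lemma IDef.forall_fin {c n : ℕ} (hc : ordVar c ∈ V) {P : Fin n → RowPred.{u, v, w} L}
    (h : ∀ j, IDef Q V (P j)) : IDef Q V fun M 𝔐 f s => ∀ j, P j M 𝔐 f s := by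
  induction n with
  -- The empty conjunction is expressed by `c = c`, which needs some variable in `V`.
  | zero => exact (IDef.eq hc hc).congr fun M _ 𝔐 f s => by simp
  | succ n ih =>
    refine ((h 0).and (ih fun j => h j.succ)).congr fun M _ 𝔐 f s => ?_
    rw [Fin.forall_fin_succ]

/-- The guards are complementary and depend only on the pair, so they leave a single way to split
the team, and both parts are row teams. An unguarded disjunction could separate rows of the same
pair. -/
lemma IDef.guardedOr {i j : ℕ} (hi : ordVar i ∈ V) (hj : ordVar j ∈ V) (h : IDef Q V P)
    (h' : IDef Q V P') :
    IDef Q V fun M 𝔐 f s => (s i = s j ∧ P M 𝔐 f s) ∨ (s i ≠ s j ∧ P' M 𝔐 f s) := by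
  obtain ⟨φ, hφ⟩ := h
  obtain ⟨φ', hφ'⟩ := h'
  refine ⟨.or (.and (.lit (.eq (varT hi) (varT hj))) φ)
    (.and (.lit (.neq (varT hi) (varT hj))) φ'), fun M _ 𝔐 S hS => ?_⟩
  have hsub : ∀ T ⊆ S, OrdInj V T := fun T hT p hp q hq => hS p (hT hp) q (hT hq)
  have hl : ∀ s f u, (Literal.eq (varT hi) (varT hj) : Literal L V).Sat (res V (row s f u)) ↔
      (s i : M) = s j := fun s f u => by simp [Literal.Sat]
  have hn : ∀ s f u, (Literal.neq (varT hi) (varT hj) : Literal L V).Sat (res V (row s f u)) ↔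
      (s i : M) ≠ s j := fun s f u => by simp [Literal.Sat]
  let S₁ := {p ∈ S | p.1 i = p.1 j}
  let S₂ := {p ∈ S | p.1 i ≠ p.1 j}
  simp only [IFormula.Sat]
  constructor
  · rintro ⟨Y, Z, hX, ⟨hY, hYφ⟩, hZ, hZφ⟩ p hp
    have h1 : Y = rowTeam V S₁ := by
      ext r
      constructor
      · intro hr
        obtain ⟨q, hq, u, rfl⟩ : r ∈ rowTeam V S := hX ▸ .inl hr
        exact ⟨q, ⟨hq, (hl _ _ _).1 (hY _ hr)⟩, u, rfl⟩
      · rintro ⟨q, ⟨hq, hqe⟩, u, rfl⟩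
        have : res V (row q.1 q.2 u) ∈ Y ∪ Z := hX ▸ ⟨q, hq, u, rfl⟩
        exact this.resolve_right fun h => (hn _ _ _).1 (hZ _ h) hqe
    have h2 : Z = rowTeam V S₂ := by
      ext r
      constructor
      · intro hr
        obtain ⟨q, hq, u, rfl⟩ : r ∈ rowTeam V S := hX ▸ .inr hr
        exact ⟨q, ⟨hq, (hn _ _ _).1 (hZ _ hr)⟩, u, rfl⟩
      · rintro ⟨q, ⟨hq, hqe⟩, u, rfl⟩
        have : res V (row q.1 q.2 u) ∈ Y ∪ Z := hX ▸ ⟨q, hq, u, rfl⟩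
        exact this.resolve_left fun h => hqe ((hl _ _ _).1 (hY _ h))
    rw [h1, hφ M 𝔐 S₁ (hsub _ fun _ h => h.1)] at hYφ
    rw [h2, hφ' M 𝔐 S₂ (hsub _ fun _ h => h.1)] at hZφ
    by_cases he : p.1 i = p.1 j
    · exact .inl ⟨he, hYφ p ⟨hp, he⟩⟩
    · exact .inr ⟨he, hZφ p ⟨hp, he⟩⟩
  · intro hP
    refine ⟨rowTeam V S₁, rowTeam V S₂, ?_, ⟨?_, ?_⟩, ?_, ?_⟩
    · ext r
      constructor
      · rintro ⟨q, hq, u, rfl⟩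
        by_cases he : q.1 i = q.1 j
        · exact .inl ⟨q, ⟨hq, he⟩, u, rfl⟩
        · exact .inr ⟨q, ⟨hq, he⟩, u, rfl⟩
      · rintro (⟨q, hq, u, rfl⟩ | ⟨q, hq, u, rfl⟩) <;> exact ⟨q, hq.1, u, rfl⟩
    · rintro _ ⟨q, hq, u, rfl⟩
      exact (hl _ _ _).2 hq.2
    · rw [hφ M 𝔐 S₁ (hsub _ fun _ h => h.1)]
      exact fun p hp => ((hP p hp.1).resolve_right fun h => h.1 hp.2).2
    · rintro _ ⟨q, hq, u, rfl⟩
      exact (hn _ _ _).2 hq.2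
    · rw [hφ' M 𝔐 S₂ (hsub _ fun _ h => h.1)]
      exact fun p hp => ((hP p hp.1).resolve_left fun h => hp.2 h.1).2

/-- The fresh variable `d` announces the disjunct chosen for a pair: the first if `d = c`, the
second if `d ≠ c`. With two elements both announcements are possible. -/
lemma IDef.or {c d : ℕ} (hV : ArgClosed V) (hc : ordVar c ∈ V) (hd : ordVar d ∉ V)
    (h : IDef Q (insert (ordVar d) V) P) (h' : IDef Q (insert (ordVar d) V) P')
    (hP : ∀ (M : Type w) [Nontrivial M] 𝔐 f s a, P M 𝔐 f (Function.update s d a) ↔ P M 𝔐 f s)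
    (hP' : ∀ (M : Type w) [Nontrivial M] 𝔐 f s a,
      P' M 𝔐 f (Function.update s d a) ↔ P' M 𝔐 f s) :
    IDef Q V fun M 𝔐 f s => P M 𝔐 f s ∨ P' M 𝔐 f s := by
  refine ((h.guardedOr (i := d) (j := c) (by simp) (by simp [hc]) h').ex hV hd).congr
    fun M _ 𝔐 f s => ?_
  have hcd : c ≠ d := by rintro rfl; exact hd hc
  simp only [Function.update_self, Function.update_of_ne hcd, hP, hP']
  constructor
  · rintro ⟨a, h | h⟩
    exacts [.inl h.2, .inr h.2]
  · rintro (h | h)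
    · exact ⟨s c, .inl ⟨rfl, h⟩⟩
    · obtain ⟨a, ha⟩ := exists_ne (s c)
      exact ⟨a, .inr ⟨ha, h⟩⟩

/-- The disjunction of literals. -/
def disj (l : Literal L V) : List (Literal L V) → IFormula L k V
  | [] => .lit l
  | l' :: ls => .or (.lit l') (disj l ls)

/-- Literals are flat, so here the splitting may be done assignment by assignment. -/
lemma sat_disj (l : Literal L V) (ls : List (Literal L V)) {M : Type w} [L.Structure M]
    (X : Team V M) :
    (disj l ls : IFormula L k V).Sat Q M X ↔ ∀ r ∈ X, l.Sat r ∨ ∃ l' ∈ ls, l'.Sat r := by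
  induction ls generalizing X with
  | nil => simp [disj, IFormula.Sat]
  | cons l' ls ih =>
    simp only [disj, IFormula.Sat, ih]
    constructor
    · rintro ⟨Y, Z, rfl, hY, hZ⟩ r (hr | hr)
      · exact .inr ⟨l', by simp, hY r hr⟩
      · rcases hZ r hr with h | ⟨m, hm, h⟩
        · exact .inl h
        · exact .inr ⟨m, by simp [hm], h⟩
    · intro h
      refine ⟨{r ∈ X | l'.Sat r}, {r ∈ X | ¬ l'.Sat r}, ?_, fun r hr => hr.2, ?_⟩
      · ext r
        by_cases hr : l'.Sat r <;> simp [hr]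
      · rintro r ⟨hr, hl⟩
        rcases h r hr with h' | ⟨m, hm, h'⟩
        · exact .inl h'
        · rcases List.mem_cons.1 hm with rfl | hm
          · exact (hl h').elim
          · exact .inr ⟨m, hm, h'⟩

/-- A property of the value of a function is expressed by its value variable. -/
lemma IDef.value {i n : ℕ} (hV : ArgClosed V) (hi : valVar i n ∈ V) {z : Fin n → ℕ}
    (hz : ∀ j, ordVar (z j) ∈ V) (l : Literal L V) {R : (M : Type w) → M → (ℕ → M) → Prop}
    (hl : ∀ (M : Type w) (_ : L.Structure M) f s u, l.Sat (res V (row s f u)) ↔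
      R M (f i n fun j => u i n j) s) :
    IDef Q V fun M (_ : L.Structure M) f s => R M (f i n fun j => s (z j)) s := by
  -- Rows whose arguments differ from the values of `z` are absorbed by one of the inequalities; `l`
  -- is tested only where the value variable holds the wanted value.
  refine ⟨disj l (List.ofFn fun j => .neq (varT (hV i n hi j)) (varT (hz j))),
    fun M _ 𝔐 S _ => ?_⟩
  rw [sat_disj]
  simp only [List.mem_ofFn, exists_exists_eq_and]
  constructor
  · intro h p hp
    -- A row with the values of `z` as arguments; the default beyond `n` is irrelevant.
    let u : ℕ → ℕ → ℕ → M := fun _ _ j => if hj : j < n then p.1 (z ⟨j, hj⟩) else p.1 0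
    rcases h _ ⟨p, hp, u, rfl⟩ with h | ⟨j, hj⟩
    · simpa [hl, u] using h
    · simp [Literal.Sat, u] at hj
  · rintro h _ ⟨p, hp, u, rfl⟩
    by_cases hu : ∀ j : Fin n, u i n j = p.1 (z j)
    · left
      rw [hl]
      simpa [hu] using h p hp
    · push Not at hu
      right
      simpa [Literal.Sat] using hu

lemma IDef.value_eq {i n o : ℕ} (hV : ArgClosed V) (hi : valVar i n ∈ V) {z : Fin n → ℕ}
    (hz : ∀ j, ordVar (z j) ∈ V) (ho : ordVar o ∈ V) :
    IDef (L := L) Q V fun _ _ f s => f i n (fun j => s (z j)) = s o :=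
  IDef.value hV hi hz (.eq (varT hi) (varT ho)) (R := fun _ a s => a = s o)
    fun M _ f s u => by simp [Literal.Sat]

lemma IDef.value_ne {i n o : ℕ} (hV : ArgClosed V) (hi : valVar i n ∈ V) {z : Fin n → ℕ}
    (hz : ∀ j, ordVar (z j) ∈ V) (ho : ordVar o ∈ V) :
    IDef (L := L) Q V fun _ _ f s => f i n (fun j => s (z j)) ≠ s o :=
  IDef.value hV hi hz (.neq (varT hi) (varT ho)) (R := fun _ a s => a ≠ s o)
    fun M _ f s u => by simp [Literal.Sat]

/-! ### Quantification of functions -/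

/-- Arguments range freely in a row team, so quantifying one universally just adds it to the domain.
The value variable must still be absent: changing an argument would falsify it. -/
lemma IDef.of_insert_argVar {i n j : ℕ} (hi : valVar i n ∉ V)
    (h : IDef Q (insert (argVar i n j) V) P) : IDef Q V P := by
  obtain ⟨φ, hφ⟩ := h
  refine ⟨.all (argVar i n j) φ, fun M _ 𝔐 S hS => ?_⟩
  rw [← hφ M 𝔐 S fun p hp q hq h => hS p hp q hq fun i hi => h i (by simp [hi])]
  simp only [IFormula.Sat]
  suffices h : {s' | ∃ s ∈ rowTeam V S, ∃ a, s' = s.update (argVar i n j) a} =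
    rowTeam (insert (argVar i n j) V) S by rw [h]
  ext s'
  constructor
  · rintro ⟨_, ⟨p, hp, u, rfl⟩, a, rfl⟩
    refine ⟨p, hp, fun i' n' j' => if i' = i ∧ n' = n ∧ j' = j then a else u i' n' j', ?_⟩
    rw [res_update, res_eq_iff]
    intro x hx
    rcases var_cases x with ⟨i', rfl⟩ | ⟨i', n', j', rfl⟩ | ⟨i', n', rfl⟩
    · rw [Function.update_of_ne ordVar_ne_argVar]; simp
    · by_cases h : i' = i ∧ n' = n ∧ j' = j
      · obtain ⟨rfl, rfl, rfl⟩ := h; simp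
      · rw [Function.update_of_ne (by rwa [Ne, argVar_inj])]; simp [h]
    · rw [Function.update_of_ne valVar_ne_argVar]
      have hx' := (Finset.mem_insert.1 hx).resolve_left valVar_ne_argVar
      have h : ¬ (i' = i ∧ n' = n) := by rintro ⟨rfl, rfl⟩; exact hi hx'
      simp only [row_valVar]
      exact congrArg _ (funext fun j' => (if_neg fun hh => h ⟨hh.1, hh.2.1⟩).symm)
  · rintro ⟨p, hp, u, rfl⟩
    refine ⟨_, ⟨p, hp, u, rfl⟩, u i n j, ?_⟩
    rw [res_update, ← row_argVar p.1 p.2 u i n j, Function.update_eq_self]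

/-- The functions `f` with the `i`-th function of arity `n` changed to `g`. -/
def FunEnv.set {M : Type w} (f : FunEnv M) (i n : ℕ) (g : (Fin n → M) → M) : FunEnv M :=
  Function.update f i (Function.update (f i) n g)

lemma FunEnv.set_self {M : Type w} (f : FunEnv M) (i n : ℕ) (g : (Fin n → M) → M) :
    f.set i n g i n = g := by simp [FunEnv.set]

lemma FunEnv.set_of_ne {M : Type w} (f : FunEnv M) {i n i' n' : ℕ} (g : (Fin n → M) → M)
    (h : ¬ (i' = i ∧ n' = n)) : f.set i n g i' n' = f i' n' := by
  unfold FunEnv.set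
  by_cases hi : i' = i
  · subst hi
    rw [Function.update_self, Function.update_of_ne fun hn => h ⟨rfl, hn⟩]
  · rw [Function.update_of_ne hi]

lemma update_row_valVar {M : Type w} (s : ℕ → M) (f : FunEnv M) (u : ℕ → ℕ → ℕ → M) (i n : ℕ)
    (g : (Fin n → M) → M) :
    Function.update (row s f u) (valVar i n) (g fun j => u i n j) = row s (f.set i n g) u := by
  funext x
  rcases var_cases x with ⟨i', rfl⟩ | ⟨i', n', j, rfl⟩ | ⟨i', n', rfl⟩
  · rw [Function.update_of_ne ordVar_ne_valVar]; simp
  · rw [Function.update_of_ne valVar_ne_argVar.symm]; simp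
  · by_cases h : i' = i ∧ n' = n
    · obtain ⟨rfl, rfl⟩ := h; simp [FunEnv.set_self]
    · rw [Function.update_of_ne (by rwa [Ne, valVar_inj])]; simp [FunEnv.set_of_ne _ _ h]

open Classical in
-- The atom with the value variable on both sides is a dependence atom: rows with equal ordinary
-- variables and arguments have equal values. Since the ordinary variables determine the pair, this
-- yields one function for each pair.
lemma IDef.ex_valVar {i n : ℕ}
    (ha : ∀ j : Fin n, argVar i n j ∈ V) (h : IDef Q (insert (valVar i n) V) P) :
    IDef Q V fun M 𝔐 f s => ∃ g, P M 𝔐 (f.set i n g) s := by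
  obtain ⟨φ, hφ⟩ := h
  have hord : ∀ i', ordVar i' ∈ insert (valVar i n) V ↔ ordVar i' ∈ V := fun i' => by
    simp [ordVar_ne_valVar]
  refine ⟨.ex (valVar i n) (.and (.indep (sel _ fun x => x = valVar i n)
    (sel _ fun x => (∃ i, x = ordVar i) ∨ ∃ j : Fin n, x = argVar i n j)
    (sel _ fun x => x = valVar i n)) φ), fun M _ 𝔐 S hS => ?_⟩
  have hinj : ∀ G : (ℕ → M) × FunEnv M → (Fin n → M) → M, OrdInj (insert (valVar i n) V)
      ((fun p => (p.1, p.2.set i n (G p))) '' S) := by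
    rintro G _ ⟨p, hp, rfl⟩ _ ⟨q, hq, rfl⟩ h
    rw [hS p hp q hq fun i hi => h i ((hord i).2 hi)]
  have key : ∀ (y : rowTeam V S → M) (G : (ℕ → M) × FunEnv M → (Fin n → M) → M),
      (∀ p (hp : p ∈ S) u, y ⟨_, p, hp, u, rfl⟩ = G p fun j => u i n j) →
      {s' | ∃ s : rowTeam V S, s' = s.1.update (valVar i n) (y s)} =
        rowTeam (insert (valVar i n) V) ((fun p => (p.1, p.2.set i n (G p))) '' S) := by
    intro y G hy
    ext s'
    constructor
    · rintro ⟨⟨_, p, hp, u, rfl⟩, rfl⟩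
      refine ⟨_, ⟨p, hp, rfl⟩, u, ?_⟩
      rw [hy p hp u, res_update, update_row_valVar]
    · rintro ⟨_, ⟨p, hp, rfl⟩, u, rfl⟩
      refine ⟨⟨_, p, hp, u, rfl⟩, ?_⟩
      rw [hy p hp u, res_update, update_row_valVar]
  simp only [IFormula.Sat]
  constructor
  · rintro ⟨y, hind, hsat⟩ p hp
    -- Extends a tuple of arguments to a full choice of arguments; by `hy` the default `c` has no
    -- influence on the chosen value.
    let U : (Fin n → M) → M → ℕ → ℕ → ℕ → M := fun v c _ _ j =>
      if hj : j < n then v ⟨j, hj⟩ else c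
    have hy : ∀ q (hq : q ∈ S) u u', (∀ j : Fin n, u i n j = u' i n j) →
        y ⟨_, q, hq, u, rfl⟩ = y ⟨_, q, hq, u', rfl⟩ := by
      intro q hq u u' huu
      obtain ⟨_, ⟨r, rfl⟩, -, h2, h3⟩ := hind _ ⟨⟨_, q, hq, u, rfl⟩, rfl⟩
        _ ⟨⟨_, q, hq, u', rfl⟩, rfl⟩ (by
          simp only [res_update]
          rw [sel_map_eq]
          rintro _ - (⟨i', rfl⟩ | ⟨j, rfl⟩)
          · rw [Function.update_of_ne ordVar_ne_valVar, Function.update_of_ne ordVar_ne_valVar]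
            simp
          · rw [Function.update_of_ne valVar_ne_argVar.symm,
              Function.update_of_ne valVar_ne_argVar.symm]
            simpa using huu j)
      obtain ⟨_, q', hq', u'', rfl⟩ := r
      simp only [res_update] at h2 h3
      rw [sel_map_eq] at h2 h3
      have h2 := h2 _ (Finset.mem_insert_self _ _) rfl
      have h3 := h3 _ (Finset.mem_insert_self _ _) rfl
      simp only [Function.update_self] at h2 h3
      exact h2.symm.trans h3
    let G : (ℕ → M) × FunEnv M → (Fin n → M) → M := fun q v =>
      if hq : q ∈ S then y ⟨_, q, hq, U v (q.1 0), rfl⟩ else q.1 0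
    rw [key y G fun q hq u => ?_, hφ M 𝔐 _ (hinj G)] at hsat
    · exact ⟨G p, hsat _ ⟨p, hp, rfl⟩⟩
    · simp only [G, dif_pos hq]
      exact hy q hq _ _ fun j => by simp [U]
  · intro hP
    choose! G hG using hP
    have hchoose : ∀ p (hp : p ∈ S) u (h : res V (row p.1 p.2 u) ∈ rowTeam V S),
        h.choose = p := fun p hp u h => by
      obtain ⟨hq, u', hu'⟩ := h.choose_spec
      exact (hS.eq_of_row hp hq hu').symm
    refine ⟨fun r => G r.2.choose fun j => r.1 ⟨_, ha j⟩, ?_⟩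
    rw [key (fun r => G r.2.choose fun j => r.1 ⟨_, ha j⟩) G fun p hp u => ?_]
    · refine ⟨?_, ?_⟩
      · rintro _ ⟨_, ⟨p, hp, rfl⟩, u, rfl⟩ _ ⟨_, ⟨q, hq, rfl⟩, u', rfl⟩ hpq
        rw [sel_map_eq] at hpq
        obtain rfl : p = q := by
          refine hS p hp q hq fun i' hi' => ?_
          simpa using hpq (ordVar i') ((hord i').2 hi') (.inl ⟨i', rfl⟩)
        refine ⟨_, ⟨_, ⟨p, hp, rfl⟩, u, rfl⟩, rfl, rfl, ?_⟩
        rw [sel_map_eq]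
        rintro _ - rfl
        simp only [row_valVar]
        refine congrArg _ (funext fun j => ?_)
        simpa using hpq (argVar i n j) (Finset.mem_insert_of_mem (ha j)) (.inr ⟨j, rfl⟩)
      · rw [hφ M 𝔐 _ (hinj G)]
        rintro _ ⟨p, hp, rfl⟩
        exact hG p hp
    · simp only
      rw [hchoose p hp u ⟨p, hp, u, rfl⟩]
      simp [res]

/-- `V` together with the arguments and the value of the `i`-th function of arity `n`. -/
def addFun (V : Finset ℕ) (i n : ℕ) : Finset ℕ :=
  insert (valVar i n) (V ∪ (Finset.range n).image (argVar i n))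

lemma ordVar_mem_addFun {i n j : ℕ} : ordVar j ∈ addFun V i n ↔ ordVar j ∈ V := by
  simp [addFun, ordVar_ne_valVar, ordVar_ne_argVar.symm]

lemma valVar_mem_addFun {i n i' n' : ℕ} :
    valVar i' n' ∈ addFun V i n ↔ (i' = i ∧ n' = n) ∨ valVar i' n' ∈ V := by
  simp [addFun, valVar_inj, valVar_ne_argVar.symm]

lemma ArgClosed.addFun (hV : ArgClosed V) (i n : ℕ) : ArgClosed (addFun V i n) := by
  intro i' n' h j
  rcases valVar_mem_addFun.1 h with ⟨rfl, rfl⟩ | h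
  · simp [TeamLogic.addFun, argVar_inj]
  · simp [TeamLogic.addFun, hV i' n' h j]

lemma IDef.exFun {i n : ℕ} (hi : valVar i n ∉ V) (h : IDef Q (addFun V i n) P) :
    IDef Q V fun M 𝔐 f s => ∃ g, P M 𝔐 (f.set i n g) s := by
  have step : ∀ (J : Finset ℕ) (P : RowPred.{u, v, w} L),
      IDef Q (V ∪ J.image (argVar i n)) P → IDef Q V P := by
    intro J
    induction J using Finset.induction_on with
    | empty => intro P h; simpa using h
    | insert j J _ ih =>
      intro P h
      rw [Finset.image_insert, Finset.union_insert] at h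
      exact ih P (h.of_insert_argVar (by simp [hi, valVar_ne_argVar.symm]))
  exact step _ _ (h.ex_valVar fun j => by simp [argVar_inj])

end IDef

/-! ### From `ESO(Q)` to `I(Q)` in structures with at least two elements -/

/-- An interpretation of the symbols of `L'` by symbols of `L` and function variables. -/
structure SymInterp (L' L : FirstOrder.Language.{u, v}) where
  /-- The interpretation of the function symbols. -/
  fn : {n : ℕ} → L'.Functions n → L.Functions n ⊕ ℕ
  /-- The interpretation of the relation symbols. -/
  rel : {n : ℕ} → L'.Relations n → L.Relations n ⊕ ℕ

namespace SymInterp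
variable {L' L : FirstOrder.Language.{u, v}} {M : Type w}

/-- The structure given by an interpretation: a function variable stands for the relation of
taking the value `c`. -/
@[reducible] def str (ι : SymInterp L' L) (𝔐 : L.Structure M) (f : FunEnv M) (c : M) :
    L'.Structure M where
  funMap {n} g a := Sum.elim (fun g => 𝔐.funMap g a) (fun i => f i n a) (ι.fn g)
  RelMap {n} R a := Sum.elim (fun R => 𝔐.RelMap R a) (fun i => f i n a = c) (ι.rel R)

/-- A new function symbol is interpreted by the `b`-th function variable. -/
def addFun (ι : SymInterp L' L) (b n : ℕ) : SymInterp (L'.sum (funVocab n)) L where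
  fn g := match g with
    | .inl g => ι.fn g
    | .inr _ => .inr b
  rel R := match R with
    | .inl R => ι.rel R
    | .inr R => Empty.elim R

/-- A new relation symbol is interpreted by the `b`-th function variable. -/
def addRel (ι : SymInterp L' L) (b n : ℕ) : SymInterp (L'.sum (relVocab n)) L where
  fn g := match g with
    | .inl g => ι.fn g
    | .inr g => Empty.elim g
  rel R := match R with
    | .inl R => ι.rel R
    | .inr _ => .inr b

/-- The variables in `V` suffice for `ι`; the ordinary variables from `d` on and the function
variables from `b` on are unused. -/
structure Ready (ι : SymInterp L' L) (V : Finset ℕ) (d b : ℕ) : Prop where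
  closed : ArgClosed V
  zero_mem : ordVar 0 ∈ V
  ord_lt : ∀ i, ordVar i ∈ V → i < d
  val_lt : ∀ i n, valVar i n ∈ V → i < b
  fn_mem : ∀ {n i} (g : L'.Functions n), ι.fn g = .inr i → valVar i n ∈ V
  rel_mem : ∀ {n i} (R : L'.Relations n), ι.rel R = .inr i → valVar i n ∈ V

variable {ι : SymInterp L' L} {V : Finset ℕ} {d b : ℕ}

lemma str_funMap_inl {n : ℕ} {g : L'.Functions n} {g' : L.Functions n} (h : ι.fn g = .inl g')
    (𝔐 : L.Structure M) (f : FunEnv M) (c : M) (a : Fin n → M) :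
    (ι.str 𝔐 f c).funMap g a = 𝔐.funMap g' a := congrArg (Sum.elim _ _) h

lemma str_funMap_inr {n i : ℕ} {g : L'.Functions n} (h : ι.fn g = .inr i)
    (𝔐 : L.Structure M) (f : FunEnv M) (c : M) (a : Fin n → M) :
    (ι.str 𝔐 f c).funMap g a = f i n a := congrArg (Sum.elim _ _) h

lemma str_relMap_inl {n : ℕ} {R : L'.Relations n} {R' : L.Relations n} (h : ι.rel R = .inl R')
    (𝔐 : L.Structure M) (f : FunEnv M) (c : M) (a : Fin n → M) :
    (ι.str 𝔐 f c).RelMap R a ↔ 𝔐.RelMap R' a := iff_of_eq (congrArg (Sum.elim _ _) h)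

lemma str_relMap_inr {n i : ℕ} {R : L'.Relations n} (h : ι.rel R = .inr i)
    (𝔐 : L.Structure M) (f : FunEnv M) (c : M) (a : Fin n → M) :
    (ι.str 𝔐 f c).RelMap R a ↔ f i n a = c := iff_of_eq (congrArg (Sum.elim _ _) h)

lemma Ready.addOrd (h : ι.Ready V d b) (n : ℕ) : ι.Ready (addOrd V n d) (d + n) b where
  closed := h.closed.addOrd n d
  zero_mem := mem_addOrd.2 (.inl h.zero_mem)
  ord_lt i hi := by
    rcases mem_addOrd.1 hi with hi | ⟨j, hj⟩
    · have := h.ord_lt i hi; omega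
    · have := ordVar_inj.1 hj; omega
  val_lt i n hi := by
    rcases mem_addOrd.1 hi with hi | ⟨j, hj⟩
    · exact h.val_lt i n hi
    · exact absurd hj.symm ordVar_ne_valVar
  fn_mem g hg := mem_addOrd.2 (.inl (h.fn_mem g hg))
  rel_mem R hR := mem_addOrd.2 (.inl (h.rel_mem R hR))

lemma Ready.insert (h : ι.Ready V d b) : ι.Ready (insert (ordVar d) V) (d + 1) b := by
  have := h.addOrd 1
  rwa [addOrd_succ, addOrd_zero] at this

lemma Ready.notMem (h : ι.Ready V d b) (j : ℕ) : ordVar (d + j) ∉ V := fun hj => by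
  have := h.ord_lt _ hj; omega

lemma Ready.notMem_self (h : ι.Ready V d b) : ordVar d ∉ V := h.notMem 0

lemma Ready.addFun (h : ι.Ready V d b) (n : ℕ) :
    (ι.addFun b n).Ready (TeamLogic.addFun V b n) d (b + 1) where
  closed := h.closed.addFun b n
  zero_mem := ordVar_mem_addFun.2 h.zero_mem
  ord_lt i hi := h.ord_lt i (ordVar_mem_addFun.1 hi)
  val_lt i n hi := by
    rcases valVar_mem_addFun.1 hi with hi | hi
    · omega
    · have := h.val_lt i n hi; omega
  fn_mem := by
    rintro m i (g | ⟨⟨⟩⟩) hg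
    · exact valVar_mem_addFun.2 (.inr (h.fn_mem g hg))
    · cases hg
      exact valVar_mem_addFun.2 (.inl ⟨rfl, rfl⟩)
  rel_mem := by
    rintro m i (R | ⟨⟨⟩⟩) hR
    exact valVar_mem_addFun.2 (.inr (h.rel_mem R hR))

lemma Ready.addRel (h : ι.Ready V d b) (n : ℕ) :
    (ι.addRel b n).Ready (TeamLogic.addFun V b n) d (b + 1) where
  closed := h.closed.addFun b n
  zero_mem := ordVar_mem_addFun.2 h.zero_mem
  ord_lt i hi := h.ord_lt i (ordVar_mem_addFun.1 hi)
  val_lt i n hi := by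
    rcases valVar_mem_addFun.1 hi with hi | hi
    · omega
    · have := h.val_lt i n hi; omega
  fn_mem := by
    rintro m i (g | ⟨⟨⟩⟩) hg
    exact valVar_mem_addFun.2 (.inr (h.fn_mem g hg))
  rel_mem := by
    rintro m i (R | ⟨⟨⟩⟩) hR
    · exact valVar_mem_addFun.2 (.inr (h.rel_mem R hR))
    · cases hR
      exact valVar_mem_addFun.2 (.inl ⟨rfl, rfl⟩)

lemma Ready.set_fn (h : ι.Ready V d b) (f : FunEnv M) {n m i : ℕ} (g : (Fin n → M) → M)
    {G : L'.Functions m} (hG : ι.fn G = .inr i) : f.set b n g i m = f i m :=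
  f.set_of_ne g fun hi => by have := h.val_lt _ _ (h.fn_mem G hG); omega

lemma Ready.set_rel (h : ι.Ready V d b) (f : FunEnv M) {n m i : ℕ} (g : (Fin n → M) → M)
    {R : L'.Relations m} (hR : ι.rel R = .inr i) : f.set b n g i m = f i m :=
  f.set_of_ne g fun hi => by have := h.val_lt _ _ (h.rel_mem R hR); omega

/-- The index `b` is fresh: by `val_lt` every symbol interpreted earlier uses a smaller one, so
changing the function `b` leaves the old symbols alone. -/
lemma Ready.str_addFun (h : ι.Ready V d b) (𝔐 : L.Structure M) (f : FunEnv M) (c : M) {n : ℕ}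
    (g : (Fin n → M) → M) : (ι.addFun b n).str 𝔐 (f.set b n g) c =
      @FirstOrder.Language.sumStructure L' (funVocab n) M (ι.str 𝔐 f c) (funStructure g) := by
  ext m S a
  · rcases S with S | ⟨⟨⟩⟩
    · change Sum.elim _ _ (ι.fn S) = Sum.elim _ _ (ι.fn S)
      rcases hS : ι.fn S with S' | i
      · rfl
      · exact congrFun (h.set_fn f g hS) a
    · exact congrFun (f.set_self b n g) a
  · rcases S with S | ⟨⟨⟩⟩
    change Sum.elim _ _ (ι.rel S) ↔ Sum.elim _ _ (ι.rel S)
    rcases hS : ι.rel S with S' | i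
    · rfl
    · exact iff_of_eq (congrArg (· = c) (congrFun (h.set_rel f g hS) a))

lemma Ready.str_addRel (h : ι.Ready V d b) (𝔐 : L.Structure M) (f : FunEnv M) (c : M) {n : ℕ}
    (g : (Fin n → M) → M) : (ι.addRel b n).str 𝔐 (f.set b n g) c =
      @FirstOrder.Language.sumStructure L' (relVocab n) M (ι.str 𝔐 f c)
        (relStructure {a | g a = c}) := by
  ext m S a
  · rcases S with S | ⟨⟨⟩⟩
    change Sum.elim _ _ (ι.fn S) = Sum.elim _ _ (ι.fn S)
    rcases hS : ι.fn S with S' | i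
    · rfl
    · exact congrFun (h.set_fn f g hS) a
  · rcases S with S | ⟨⟨⟩⟩
    · change Sum.elim _ _ (ι.rel S) ↔ Sum.elim _ _ (ι.rel S)
      rcases hS : ι.rel S with S' | i
      · rfl
      · exact iff_of_eq (congrArg (· = c) (congrFun (h.set_rel f g hS) a))
    · exact iff_of_eq (congrArg (· = c) (congrFun (f.set_self b n g) a))

end SymInterp

/-! ### Terms, literals and renaming of variables -/

section
variable {L' L : FirstOrder.Language.{u, v}} {k : ℕ} {Q : GenQuantifier.{w} k} {V W : Finset ℕ}
  {ι : SymInterp L' L} {d b : ℕ} {ρ : {x : ℕ // x ∈ W} → ℕ}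

/-- The value of a term in the structure given by an interpretation. -/
def tval {M : Type w} (ι : SymInterp L' L) (ρ : {x : ℕ // x ∈ W} → ℕ)
    (t : L'.Term {x : ℕ // x ∈ W}) (𝔐 : L.Structure M) (f : FunEnv M) (s : ℕ → M) : M :=
  @FirstOrder.Language.Term.realize L' M (ι.str 𝔐 f (s 0)) _ (fun x => s (ρ x)) t

lemma tval_congr {M : Type w} (t : L'.Term {x : ℕ // x ∈ W}) (𝔐 : L.Structure M) (f : FunEnv M)
    {s s' : ℕ → M} (h0 : s 0 = s' 0) (h : ∀ x, s (ρ x) = s' (ρ x)) :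
    tval ι ρ t 𝔐 f s = tval ι ρ t 𝔐 f s' := by
  simp only [tval, h]
  rw [h0]

lemma ESOFormula.sat_congr {M : Type w} (θ : ESOFormula k L' W) {𝔐 𝔐' : L'.Structure M}
    {s s' : Assignment W M} (h : 𝔐 = 𝔐') (hs : s = s') : θ.Sat Q M 𝔐 s ↔ θ.Sat Q M 𝔐' s' := by
  rw [h, hs]

/-- Unnesting of terms: fresh ordinary variables guess the values, and equations verify the guesses.
This is needed because function variables can be evaluated only at ordinary variables. In `hts` the
set `V` varies because the equations live over the enlarged set. -/
lemma IDef.substTerms {n : ℕ} (ts : Fin n → L'.Term {x : ℕ // x ∈ W})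
    (hts : ∀ j, ∀ {V : Finset ℕ} {d : ℕ}, ι.Ready V d b → (∀ x, ordVar (ρ x) ∈ V) → ∀ {o},
      ordVar o ∈ V → IDef Q V fun _ 𝔐 f s => tval ι ρ (ts j) 𝔐 f s = s o)
    (hι : ι.Ready V d b) (hρ : ∀ x, ordVar (ρ x) ∈ V) {P : RowPred.{u, v, w} L}
    (h : IDef Q (addOrd V n d) P) :
    IDef Q V fun M 𝔐 f s => P M 𝔐 f (updN s d fun j => tval ι ρ (ts j) 𝔐 f s) := by
  have hι' := hι.addOrd n
  have hsub : ∀ x ∈ V, x ∈ addOrd V n d := fun x hx => mem_addOrd.2 (.inl hx)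
  refine (IDef.exTuple hι.closed hι.ord_lt ((IDef.forall_fin hι'.zero_mem fun j =>
    hts j hι' (fun x => hsub _ (hρ x)) (o := d + j) (mem_addOrd.2 (.inr ⟨j, rfl⟩))).and h)).congr
    fun M _ 𝔐 f s => ?_
  have h0 := hι.ord_lt 0 hι.zero_mem
  have hval : ∀ j (a : Fin n → M), tval ι ρ (ts j) 𝔐 f (updN s d a) = tval ι ρ (ts j) 𝔐 f s :=
    fun j a => tval_congr _ _ _ (updN_of_lt _ _ _ h0)
      fun x => updN_of_lt _ _ _ (hι.ord_lt _ (hρ x))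
  simp only [hval, updN_add]
  constructor
  · rintro ⟨a, ha, h⟩
    obtain rfl : (fun j => tval ι ρ (ts j) 𝔐 f s) = a := funext ha
    exact h
  · exact fun h => ⟨_, fun _ => rfl, h⟩

lemma IDef.tval_eq (t : L'.Term {x : ℕ // x ∈ W}) (hι : ι.Ready V d b)
    (hρ : ∀ x, ordVar (ρ x) ∈ V) {o : ℕ} (ho : ordVar o ∈ V) :
    IDef Q V fun _ 𝔐 f s => tval ι ρ t 𝔐 f s = s o := by
  induction t generalizing V d o with
  | var x => exact (IDef.eq (hρ x) ho).congr fun M _ 𝔐 f s => Iff.rfl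
  | @func n g ts ih =>
    have hsub : ∀ x ∈ V, x ∈ addOrd V n d := fun x hx => mem_addOrd.2 (.inl hx)
    have hz : ∀ j : Fin n, ordVar (d + j) ∈ addOrd V n d := fun j => mem_addOrd.2 (.inr ⟨j, rfl⟩)
    have ho' := hι.ord_lt o ho
    rcases hg : ι.fn g with g' | i
    · refine (IDef.substTerms ts (fun j _ _ => ih j) hι hρ
        (IDef.func g' hz (hsub _ ho))).congr fun M _ 𝔐 f s => ?_
      simp only [updN_add, updN_of_lt _ _ _ ho']
      exact iff_of_eq (congrArg (· = s o) (SymInterp.str_funMap_inl hg 𝔐 f (s 0) _)).symm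
    · refine (IDef.substTerms ts (fun j _ _ => ih j) hι hρ
        (IDef.value_eq (hι.addOrd n).closed (hsub _ (hι.fn_mem g hg)) hz (hsub _ ho))).congr
        fun M _ 𝔐 f s => ?_
      simp only [updN_add, updN_of_lt _ _ _ ho']
      exact iff_of_eq (congrArg (· = s o) (SymInterp.str_funMap_inr hg 𝔐 f (s 0) _)).symm

lemma IDef.ofLiteral (l : Literal L' W) (hι : ι.Ready V d b) (hρ : ∀ x, ordVar (ρ x) ∈ V) :
    IDef Q V fun M 𝔐 f s =>
      @Literal.Sat L' W M (ι.str 𝔐 f (s 0)) (fun x => s (ρ x)) l := by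
  have hsub : ∀ n, ∀ x ∈ V, x ∈ addOrd V n d := fun n x hx => mem_addOrd.2 (.inl hx)
  have hz : ∀ n (j : Fin n), ordVar (d + j) ∈ addOrd V n d :=
    fun n j => mem_addOrd.2 (.inr ⟨j, rfl⟩)
  have h0 := hι.ord_lt 0 hι.zero_mem
  have hsubst : ∀ {n} (ts : Fin n → L'.Term {x : ℕ // x ∈ W}) {P : RowPred.{u, v, w} L},
      IDef Q (addOrd V n d) P →
      IDef Q V fun M 𝔐 f s => P M 𝔐 f (updN s d fun j => tval ι ρ (ts j) 𝔐 f s) :=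
    fun ts _ => IDef.substTerms ts (fun j _ _ h h' _ => IDef.tval_eq (ts j) h h') hι hρ
  cases l with
  | eq t₁ t₂ =>
    refine (hsubst ![t₁, t₂] (IDef.eq (hz 2 0) (hz 2 1))).congr fun M _ 𝔐 f s => ?_
    simp only [updN_add]
    rfl
  | neq t₁ t₂ =>
    refine (hsubst ![t₁, t₂] (IDef.neq (hz 2 0) (hz 2 1))).congr fun M _ 𝔐 f s => ?_
    simp only [updN_add]
    rfl
  | @rel n R ts =>
    rcases hR : ι.rel R with R' | i
    · refine (hsubst ts (IDef.rel R' (hz n))).congr fun M _ 𝔐 f s => ?_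
      simp only [updN_add]
      exact (SymInterp.str_relMap_inl hR 𝔐 f (s 0) _).symm
    · refine (hsubst ts (IDef.value_eq (hι.addOrd n).closed (hsub n _ (hι.rel_mem R hR)) (hz n)
        (hsub n _ hι.zero_mem))).congr fun M _ 𝔐 f s => ?_
      simp only [updN_add, updN_of_lt _ _ _ h0]
      exact (SymInterp.str_relMap_inr hR 𝔐 f (s 0) _).symm
  | @nrel n R ts =>
    rcases hR : ι.rel R with R' | i
    · refine (hsubst ts (IDef.nrel R' (hz n))).congr fun M _ 𝔐 f s => ?_
      simp only [updN_add]
      exact not_congr (SymInterp.str_relMap_inl hR 𝔐 f (s 0) _).symm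
    · refine (hsubst ts (IDef.value_ne (hι.addOrd n).closed (hsub n _ (hι.rel_mem R hR)) (hz n)
        (hsub n _ hι.zero_mem))).congr fun M _ 𝔐 f s => ?_
      simp only [updN_add, updN_of_lt _ _ _ h0]
      exact not_congr (SymInterp.str_relMap_inr hR 𝔐 f (s 0) _).symm

/-- The names of the variables after a variable `y` with name `d` has been quantified. -/
def extName (ρ : {x : ℕ // x ∈ W} → ℕ) (y d : ℕ) : {x : ℕ // x ∈ insert y W} → ℕ := fun z =>
  if h : z.1 = y then d else ρ ⟨z.1, Finset.mem_of_mem_insert_of_ne z.2 h⟩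

/-- The names of the variables after a tuple `x` with names `d, d + 1, …` has been quantified. -/
noncomputable def extNames (ρ : {x : ℕ // x ∈ W} → ℕ) (x : Fin k ↪ ℕ) (d : ℕ) :
    {z : ℕ // z ∈ W ∪ Finset.univ.map x} → ℕ := fun z =>
  if h : ∃ i, x i = z.1 then d + h.choose
  else ρ ⟨z.1, (Finset.mem_union.mp z.2).resolve_right fun hz => h (by simpa using hz)⟩

lemma extName_mem (hρ : ∀ x, ordVar (ρ x) ∈ V) (y : ℕ) (z) :
    ordVar (extName ρ y d z) ∈ insert (ordVar d) V := by
  unfold extName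
  split_ifs
  · simp
  · simp [hρ]

lemma extNames_mem (hρ : ∀ x, ordVar (ρ x) ∈ V) (x : Fin k ↪ ℕ) (z) :
    ordVar (extNames ρ x d z) ∈ addOrd V k d := by
  rw [mem_addOrd]
  unfold extNames
  split_ifs with h
  · exact .inr ⟨_, rfl⟩
  · exact .inl (hρ _)

lemma update_comp_extName (hι : ι.Ready V d b) (hρ : ∀ x, ordVar (ρ x) ∈ V) (y : ℕ)
    {M : Type w} (s : ℕ → M) (a : M) :
    (fun z => Function.update s d a (extName ρ y d z)) =
      Assignment.update (fun x => s (ρ x)) y a := by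
  funext z
  unfold extName Assignment.update
  split_ifs with h
  · simp
  · rw [Function.update_of_ne (hι.ord_lt _ (hρ _)).ne]

lemma updN_comp_extNames (hι : ι.Ready V d b) (hρ : ∀ x, ordVar (ρ x) ∈ V) (x : Fin k ↪ ℕ)
    {M : Type w} (s : ℕ → M) (a : Fin k → M) :
    (fun z => updN s d a (extNames ρ x d z)) =
      Assignment.updateTuple (fun x => s (ρ x)) x a := by
  funext z
  unfold extNames Assignment.updateTuple
  split_ifs with h
  · rw [updN_add]
  · rw [updN_of_lt _ _ _ (hι.ord_lt _ (hρ _))]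

end

/-! ### The translation of ESO(Q) for at least two elements -/

section
variable {L : FirstOrder.Language.{u, v}} {k : ℕ} {Q : GenQuantifier.{w} k}

open Classical in
-- The ordinary variable `0` holds the point `c` used to code relations. Every quantified variable
-- gets the fresh name `d`, even when it is quantified again; overwriting an old value could make
-- the ordinary variables lose track of the pair.
theorem IDef.ofESO (hmono : Q.Monotone) (hnontriv : Q.NonTrivial)
    {L' : FirstOrder.Language.{u, v}} {W : Finset ℕ} (θ : ESOFormula k L' W) :
    ∀ {ι : SymInterp L' L} {ρ : {x : ℕ // x ∈ W} → ℕ} {V : Finset ℕ} {d b : ℕ},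
      ι.Ready V d b → (∀ x, ordVar (ρ x) ∈ V) →
      IDef Q V fun M 𝔐 f s => θ.Sat Q M (ι.str 𝔐 f (s 0)) fun x => s (ρ x) := by
  induction θ with
  | lit l => intro ι ρ V d b hι hρ; exact IDef.ofLiteral l hι hρ
  | and φ ψ ihφ ihψ => intro ι ρ V d b hι hρ; exact (ihφ hι hρ).and (ihψ hι hρ)
  | or φ ψ ihφ ihψ =>
    intro ι ρ V d b hι hρ
    have h0 := (hι.ord_lt 0 hι.zero_mem).ne
    have hρ' : ∀ x, ordVar (ρ x) ∈ insert (ordVar d) V := fun x => by simp [hρ]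
    refine IDef.or hι.closed hι.zero_mem hι.notMem_self (ihφ hι.insert hρ') (ihψ hι.insert hρ')
      ?_ ?_ <;>
    · intro M _ 𝔐 f s a
      refine ESOFormula.sat_congr _ (by rw [Function.update_of_ne h0]) (funext fun x => ?_)
      rw [Function.update_of_ne (hι.ord_lt _ (hρ _)).ne]
  | ex y φ ih =>
    intro ι ρ V d b hι hρ
    refine ((ih hι.insert (extName_mem hρ y)).ex hι.closed hι.notMem_self).congr
      fun M _ 𝔐 f s => ?_
    exact exists_congr fun a => ESOFormula.sat_congr _
      (by rw [Function.update_of_ne (hι.ord_lt 0 hι.zero_mem).ne])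
      (update_comp_extName hι hρ y s a)
  | all y φ ih =>
    intro ι ρ V d b hι hρ
    refine ((ih hι.insert (extName_mem hρ y)).all hι.closed hι.notMem_self).congr
      fun M _ 𝔐 f s => ?_
    exact forall_congr' fun a => ESOFormula.sat_congr _
      (by rw [Function.update_of_ne (hι.ord_lt 0 hι.zero_mem).ne])
      (update_comp_extName hι hρ y s a)
  | quant x φ ih =>
    intro ι ρ V d b hι hρ
    refine ((ih (hι.addOrd k) (extNames_mem hρ x)).quant hmono hnontriv hι.closed
      fun j => hι.notMem j).congr fun M _ 𝔐 f s => ?_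
    exact iff_of_eq (congrArg (· ∈ Q M) (Set.ext fun a => ESOFormula.sat_congr _
      (by rw [updN_of_lt _ _ _ (hι.ord_lt 0 hι.zero_mem)]) (updN_comp_extNames hι hρ x s a)))
  | exRel n φ ih =>
    intro ι ρ V d b hι hρ
    refine ((ih (hι.addRel n) fun x => ordVar_mem_addFun.2 (hρ x)).exFun
      fun h => (hι.val_lt b n h).false).congr fun M _ 𝔐 f s => ?_
    simp only [hι.str_addRel]
    constructor
    · rintro ⟨g, hg⟩
      exact ⟨_, hg⟩
    · rintro ⟨R, hR⟩
      -- A second element is needed as the value outside `R`.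
      obtain ⟨e, he⟩ := exists_ne (s 0)
      refine ⟨fun a => if a ∈ R then s 0 else e, ?_⟩
      have : {a | (if a ∈ R then s 0 else e) = s 0} = R := by
        ext a
        by_cases ha : a ∈ R <;> simp [ha, he]
      rwa [this]
  | exFun n φ ih =>
    intro ι ρ V d b hι hρ
    refine ((ih (hι.addFun n) fun x => ordVar_mem_addFun.2 (hρ x)).exFun
      fun h => (hι.val_lt b n h).false).congr fun M _ 𝔐 f s => ?_
    simp only [hι.str_addFun]
    rfl

/-- The identical interpretation. -/
def SymInterp.refl (L : FirstOrder.Language.{u, v}) : SymInterp L L := ⟨.inl, .inl⟩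

theorem exists_isentence_of_nontrivial (hmono : Q.Monotone) (hnontriv : Q.NonTrivial)
    (ψ : ESOSentence L k) : ∃ φ : ISentence L k, ∀ (M : Type w) [Nontrivial M] [L.Structure M],
      ISentence.True Q M φ ↔ ESOSentence.True Q M ψ := by
  have hr : (SymInterp.refl L).Ready (insert (ordVar 0) ∅) 1 0 :=
    { closed := fun i n h => absurd h (by simp [ordVar_ne_valVar.symm])
      zero_mem := by simp
      ord_lt := fun i h => by simpa [ordVar_inj] using h
      val_lt := fun i n h => absurd h (by simp [ordVar_ne_valVar.symm])
      fn_mem := fun g h => by cases h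
      rel_mem := fun R h => by cases h }
  -- The coding point is quantified existentially; no symbol of `L` depends on it, so any value will
  -- do.
  obtain ⟨φ, hφ⟩ := (IDef.ofESO hmono hnontriv ψ hr (ρ := fun x => x.1)
    fun x => absurd x.2 (Finset.notMem_empty _)).ex (fun i n h => by simp at h) (by simp)
  refine ⟨φ, fun M _ 𝔐 => ?_⟩
  let s : ℕ → M := fun _ => Classical.arbitrary M
  let f : FunEnv M := fun _ _ _ => Classical.arbitrary M
  have h := hφ M 𝔐 {(s, f)} (by rintro _ rfl _ rfl -; rfl)
  have ht : rowTeam ∅ {(s, f)} =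
      {fun x : {x // x ∈ (∅ : Finset ℕ)} => absurd x.2 (Finset.notMem_empty x.1)} := by
    ext r
    constructor
    · rintro -
      exact funext fun x => absurd x.2 (Finset.notMem_empty _)
    · rintro -
      exact ⟨_, rfl, fun _ _ => s, eq_res_of_isEmpty _ _⟩
  rw [ht] at h
  refine h.trans ?_
  have hs : ∀ c, (SymInterp.refl L).str 𝔐 f c = 𝔐 := fun c => rfl
  have ha : ∀ a : M, (fun x : {x : ℕ // x ∈ (∅ : Finset ℕ)} => Function.update s 0 a x.1) =
      fun x => absurd x.2 (Finset.notMem_empty x.1) :=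
    fun a => funext fun x => absurd x.2 (Finset.notMem_empty _)
  simp only [Set.mem_singleton_iff, forall_eq, hs, ha, exists_const]
  rfl

end

/-! ### Structures with one element -/

section
variable {L : FirstOrder.Language.{u, v}} {k : ℕ} {Q : GenQuantifier.{w} k} {V : Finset ℕ}

/-- The empty team property: on a singleton team it lets one disjunct take everything, so `∨`
becomes Boolean there. -/
lemma IFormula.sat_empty {M : Type w} [L.Structure M] (φ : IFormula L k V) :
    φ.Sat Q M ∅ := by
  induction φ with
  | lit l => simp [IFormula.Sat]
  | indep y x z => simp [IFormula.Sat]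
  | nindep y x z => simp [IFormula.Sat]
  | and φ ψ ihφ ihψ => exact ⟨ihφ, ihψ⟩
  | or φ ψ ihφ ihψ => exact ⟨∅, ∅, by simp, ihφ, ihψ⟩
  | ex y φ ih => exact ⟨fun s => s.2.elim, by simpa using ih⟩
  | all y φ ih => simpa [IFormula.Sat] using ih
  | quant x φ ih => exact ⟨fun s => s.2.elim, fun s => s.2.elim, by simpa using ih⟩

lemma IFormula.sat_or_singleton {M : Type w} [L.Structure M] (φ ψ : IFormula L k V)
    (r : Assignment V M) :
    (φ.or ψ).Sat Q M {r} ↔ φ.Sat Q M {r} ∨ ψ.Sat Q M {r} := by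
  simp only [IFormula.Sat]
  constructor
  · rintro ⟨Y, Z, h, hY, hZ⟩
    have hY' : Y ⊆ {r} := h ▸ Set.subset_union_left
    have hZ' : Z ⊆ {r} := h ▸ Set.subset_union_right
    have hr : r ∈ Y ∪ Z := h ▸ rfl
    rcases hr with hr | hr
    · left
      rwa [hY'.antisymm (by simpa using hr)] at hY
    · right
      rwa [hZ'.antisymm (by simpa using hr)] at hZ
  · rintro (h | h)
    · exact ⟨{r}, ∅, by simp, h, sat_empty _⟩
    · exact ⟨∅, {r}, by simp, sat_empty _, h⟩

lemma IFormula.sat_lit_singleton {M : Type w} [L.Structure M] (l : Literal L V)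
    (r : Assignment V M) : (IFormula.lit l : IFormula L k V).Sat Q M {r} ↔ l.Sat r :=
  ⟨fun h => h r rfl, fun h _ hr => hr ▸ h⟩

/-- The structure on a one-element set in which each relation symbol of `L'` is interpreted by a
relation symbol of `L` or by a truth value. -/
@[reducible] def oneStr {L' : FirstOrder.Language.{u, v}}
    (ι : ∀ {n}, L'.Relations n → L.Relations n ⊕ Prop)
    {M : Type w} (𝔐 : L.Structure M) (c : M) : L'.Structure M where
  funMap _ _ := c
  RelMap R a := Sum.elim (fun R => 𝔐.RelMap R a) id (ι R)

/-- The variable `0`. -/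
abbrev var0 : L.Term {x : ℕ // x ∈ insert 0 (∅ : Finset ℕ)} := varT (Finset.mem_insert_self _ _)

lemma exists_iformula_of_relation {n : ℕ} (R : L.Relations n ⊕ Prop) :
    ∃ φ : IFormula L k (insert 0 ∅), ∀ (M : Type w) [Subsingleton M] (c : M)
      (𝔐 : L.Structure M) (a : Fin n → M),
      φ.Sat Q M {fun _ => c} ↔ Sum.elim (fun R => 𝔐.RelMap R a) id R := by
  rcases R with R | p
  · refine ⟨.lit (.rel R fun _ => var0), fun M _ c 𝔐 a => ?_⟩
    rw [IFormula.sat_lit_singleton, Subsingleton.elim a fun _ => c]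
    rfl
  · by_cases hp : p
    · exact ⟨.lit (.eq var0 var0), fun M _ c 𝔐 a => by
        rw [IFormula.sat_lit_singleton]; simp [Literal.Sat, hp]⟩
    · exact ⟨.lit (.neq var0 var0), fun M _ c 𝔐 a => by
        rw [IFormula.sat_lit_singleton]; simp [Literal.Sat, hp]⟩

lemma exists_iformula_of_not_relation {n : ℕ} (R : L.Relations n ⊕ Prop) :
    ∃ φ : IFormula L k (insert 0 ∅), ∀ (M : Type w) [Subsingleton M] (c : M)
      (𝔐 : L.Structure M) (a : Fin n → M),
      φ.Sat Q M {fun _ => c} ↔ ¬ Sum.elim (fun R => 𝔐.RelMap R a) id R := by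
  rcases R with R | p
  · refine ⟨.lit (.nrel R fun _ => var0), fun M _ c 𝔐 a => ?_⟩
    rw [IFormula.sat_lit_singleton, Subsingleton.elim a fun _ => c]
    rfl
  · by_cases hp : p
    · exact ⟨.lit (.neq var0 var0), fun M _ c 𝔐 a => by
        rw [IFormula.sat_lit_singleton]; simp [Literal.Sat, hp]⟩
    · exact ⟨.lit (.eq var0 var0), fun M _ c 𝔐 a => by
        rw [IFormula.sat_lit_singleton]; simp [Literal.Sat, hp]⟩

/-- The interpretation `ι` extended to a new relation symbol, interpreted by `p`. -/
def oneAddRel {L' : FirstOrder.Language.{u, v}} (n : ℕ)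
    (ι : ∀ {n}, L'.Relations n → L.Relations n ⊕ Prop) (p : Prop) :
    ∀ {m}, (L'.sum (relVocab n)).Relations m → L.Relations m ⊕ Prop
  | _, .inl R => ι R
  | _, .inr _ => .inr p

/-- The interpretation `ι` extended to the vocabulary with a new function symbol. -/
def oneAddFun {L' : FirstOrder.Language.{u, v}} (n : ℕ)
    (ι : ∀ {n}, L'.Relations n → L.Relations n ⊕ Prop) :
    ∀ {m}, (L'.sum (funVocab n)).Relations m → L.Relations m ⊕ Prop
  | _, .inl R => ι R
  | _, .inr R => Empty.elim R

lemma oneStr_oneAddRel {L' : FirstOrder.Language.{u, v}} (n : ℕ)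
    (ι : ∀ {n}, L'.Relations n → L.Relations n ⊕ Prop) (p : Prop) {M : Type w} [Subsingleton M]
    (𝔐 : L.Structure M) (c : M) :
    oneStr (oneAddRel n ι p) 𝔐 c = @FirstOrder.Language.sumStructure L' (relVocab n) M
      (oneStr ι 𝔐 c) (relStructure {_a | p}) := by
  ext m S a
  · exact Subsingleton.elim _ _
  · rcases S with S | ⟨⟨⟩⟩ <;> rfl

lemma oneStr_oneAddFun {L' : FirstOrder.Language.{u, v}} (n : ℕ)
    (ι : ∀ {n}, L'.Relations n → L.Relations n ⊕ Prop) {M : Type w} [Subsingleton M]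
    (𝔐 : L.Structure M) (c : M) (g : (Fin n → M) → M) :
    oneStr (oneAddFun n ι) 𝔐 c = @FirstOrder.Language.sumStructure L' (funVocab n) M
      (oneStr ι 𝔐 c) (funStructure g) := by
  ext m S a
  · exact Subsingleton.elim _ _
  · rcases S with S | ⟨⟨⟩⟩
    rfl

/-- With one element, assignments and functions carry no information, so first-order and function
quantifiers can be dropped. A set defined under `Q` is full or empty, and non-triviality lets `Q` be
dropped too. A relation is full or empty, so `∃R` becomes a disjunction of two instances. -/
theorem exists_iformula_of_subsingleton (hnontriv : Q.NonTrivial)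
    {L' : FirstOrder.Language.{u, v}} {W : Finset ℕ} (θ : ESOFormula k L' W) :
    ∀ ι : ∀ {n}, L'.Relations n → L.Relations n ⊕ Prop,
      ∃ φ : IFormula L k (insert 0 ∅), ∀ (M : Type w) [Subsingleton M] (c : M)
        (𝔐 : L.Structure M) (s : Assignment W M),
        φ.Sat Q M {fun _ => c} ↔ θ.Sat Q M (oneStr ι 𝔐 c) s := by
  induction θ with
  | lit l =>
    intro ι
    cases l with
    | eq t₁ t₂ =>
      refine ⟨.lit (.eq var0 var0), fun M _ c 𝔐 s => ?_⟩
      rw [IFormula.sat_lit_singleton]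
      simp [ESOFormula.Sat, Literal.Sat, eq_iff_true_of_subsingleton]
    | neq t₁ t₂ =>
      refine ⟨.lit (.neq var0 var0), fun M _ c 𝔐 s => ?_⟩
      rw [IFormula.sat_lit_singleton]
      simp [ESOFormula.Sat, Literal.Sat, eq_iff_true_of_subsingleton]
    | rel R ts =>
      obtain ⟨φ, hφ⟩ := exists_iformula_of_relation (Q := Q) (ι R)
      exact ⟨φ, fun M _ c 𝔐 s => hφ M c 𝔐 _⟩
    | nrel R ts =>
      obtain ⟨φ, hφ⟩ := exists_iformula_of_not_relation (Q := Q) (ι R)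
      exact ⟨φ, fun M _ c 𝔐 s => hφ M c 𝔐 _⟩
  | and φ ψ ihφ ihψ =>
    intro ι
    obtain ⟨φ', hφ⟩ := ihφ ι
    obtain ⟨ψ', hψ⟩ := ihψ ι
    exact ⟨φ'.and ψ', fun M _ c 𝔐 s => and_congr (hφ M c 𝔐 s) (hψ M c 𝔐 s)⟩
  | or φ ψ ihφ ihψ =>
    intro ι
    obtain ⟨φ', hφ⟩ := ihφ ι
    obtain ⟨ψ', hψ⟩ := ihψ ι
    refine ⟨φ'.or ψ', fun M _ c 𝔐 s => ?_⟩
    rw [IFormula.sat_or_singleton]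
    exact or_congr (hφ M c 𝔐 s) (hψ M c 𝔐 s)
  | ex y φ ih =>
    intro ι
    obtain ⟨φ', hφ⟩ := ih ι
    exact ⟨φ', fun M _ c 𝔐 s => ⟨fun h => ⟨c, (hφ M c 𝔐 _).1 h⟩,
      fun ⟨_, h⟩ => (hφ M c 𝔐 _).2 h⟩⟩
  | all y φ ih =>
    intro ι
    obtain ⟨φ', hφ⟩ := ih ι
    exact ⟨φ', fun M _ c 𝔐 s => ⟨fun h _ => (hφ M c 𝔐 _).1 h,
      fun h => (hφ M c 𝔐 _).2 (h c)⟩⟩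
  | quant x φ ih =>
    intro ι
    obtain ⟨φ', hφ⟩ := ih ι
    refine ⟨φ', fun M _ c 𝔐 s => ?_⟩
    have : Nonempty M := ⟨c⟩
    simp only [ESOFormula.Sat, ← hφ]
    constructor
    · intro h
      rw [show {_a : Fin k → M | φ'.Sat Q M {fun _ => c}} = Set.univ from
        Set.eq_univ_of_forall fun _ => h]
      exact (hnontriv M).2
    · intro h
      by_contra h'
      rw [show {_a : Fin k → M | φ'.Sat Q M {fun _ => c}} = ∅ from
        Set.eq_empty_of_forall_notMem fun _ => h'] at h
      exact (hnontriv M).1 h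
  | exRel n φ ih =>
    intro ι
    obtain ⟨φ₁, h₁⟩ := ih (oneAddRel n ι True)
    obtain ⟨φ₂, h₂⟩ := ih (oneAddRel n ι False)
    refine ⟨φ₁.or φ₂, fun M _ c 𝔐 s => ?_⟩
    rw [IFormula.sat_or_singleton, h₁ M c 𝔐 s, h₂ M c 𝔐 s, oneStr_oneAddRel, oneStr_oneAddRel]
    constructor
    · rintro (h | h) <;> exact ⟨_, h⟩
    · rintro ⟨R, hR⟩
      rcases R.eq_empty_or_nonempty with rfl | hne
      · exact .inr hR
      · obtain rfl := Subsingleton.eq_univ_of_nonempty hne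
        exact .inl hR
  | exFun n φ ih =>
    intro ι
    obtain ⟨φ', hφ⟩ := ih (oneAddFun n ι)
    refine ⟨φ', fun M _ c 𝔐 s => ?_⟩
    rw [hφ M c 𝔐 s]
    constructor
    · intro h
      rw [oneStr_oneAddFun n ι 𝔐 c fun _ => c] at h
      exact ⟨_, h⟩
    · rintro ⟨g, hg⟩
      rwa [oneStr_oneAddFun n ι 𝔐 c g]

theorem exists_isentence (hmono : Q.Monotone) (hnontriv : Q.NonTrivial) (ψ : ESOSentence L k) :
    ∃ φ : ISentence L k, ∀ (M : Type w) [Nonempty M] [L.Structure M],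
      ISentence.True Q M φ ↔ ESOSentence.True Q M ψ := by
  obtain ⟨φ₁, h₁⟩ := exists_iformula_of_subsingleton (L := L) hnontriv ψ .inl
  obtain ⟨φ₂, h₂⟩ := exists_isentence_of_nontrivial hmono hnontriv ψ
  have m0 : 0 ∈ insert 1 (insert 0 (∅ : Finset ℕ)) := by simp
  have m1 : 1 ∈ insert 1 (insert 0 (∅ : Finset ℕ)) := by simp
  -- Each disjunct first states the size of the universe. The initial `∃` of the first one also
  -- supplies the variable `0` of `φ₁`.
  refine ⟨.or (.ex 0 (.and (.all 1 (.lit (.eq (varT m0) (varT m1)))) φ₁))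
    (.and (.ex 0 (.ex 1 (.lit (.neq (varT m0) (varT m1))))) φ₂), fun M _ 𝔐 => ?_⟩
  unfold ISentence.True
  rw [IFormula.sat_or_singleton]
  rcases subsingleton_or_nontrivial M with hM | hM
  · let c : M := Classical.arbitrary M
    have hc : oneStr .inl 𝔐 c = 𝔐 := by
      ext m S a
      · exact Subsingleton.elim _ _
      · rfl
    have h := h₁ M c 𝔐 fun x => absurd x.2 (Finset.notMem_empty x.1)
    rw [hc] at h
    change _ ↔ ESOFormula.Sat Q M ψ 𝔐 _
    rw [← h]
    constructor
    · rintro (⟨f, -, hf⟩ | ⟨⟨f, g, hfg⟩, -⟩)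
      · convert hf
        ext r
        refine ⟨fun _ => ⟨⟨_, rfl⟩, Subsingleton.elim _ _⟩, fun _ => Subsingleton.elim _ _⟩
      · exact absurd (Subsingleton.elim _ _) (hfg _ ⟨⟨_, ⟨_, rfl⟩, rfl⟩, rfl⟩)
    · intro hφ
      refine .inl ⟨fun _ => c, fun _ _ => Subsingleton.elim _ _, ?_⟩
      convert hφ
      ext r
      refine ⟨fun _ => Subsingleton.elim _ _, fun _ => ⟨⟨_, rfl⟩, Subsingleton.elim _ _⟩⟩
  · rw [← h₂ M]
    constructor
    · rintro (⟨f, hf, -⟩ | ⟨-, h⟩)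
      · obtain ⟨a, ha⟩ := exists_ne (f ⟨_, rfl⟩)
        have := hf _ ⟨_, ⟨⟨_, rfl⟩, rfl⟩, a, rfl⟩
        simp [Literal.Sat, Assignment.update] at this
        exact absurd this.symm ha
      · exact h
    · intro h
      obtain ⟨a, b, hab⟩ := exists_pair_ne M
      refine .inr ⟨⟨fun _ => a, fun _ => b, ?_⟩, h⟩
      rintro _ ⟨⟨_, ⟨_, rfl⟩⟩, rfl⟩
      simpa [Literal.Sat, Assignment.update] using hab

end

/-! ### From `I(Q)` to `ESO(Q)` -/

/-- Predicates of structures and assignments. -/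
abbrev StrPred (L : FirstOrder.Language.{u, v}) : Type (max u v (w + 1)) :=
  (M : Type w) → L.Structure M → (ℕ → M) → Prop

/-- `P` is expressed by a formula of `ESO(Q)` with variables below `o`. -/
def EDef {L : FirstOrder.Language.{u, v}} {k : ℕ} (Q : GenQuantifier.{w} k) (o : ℕ)
    (P : StrPred.{u, v, w} L) : Prop :=
  ∃ ψ : ESOFormula k L (Finset.range o), ∀ (M : Type w) [Nonempty M] (𝔐 : L.Structure M)
    (s : ℕ → M), ψ.Sat Q M 𝔐 (res _ s) ↔ P M 𝔐 s

/-- The values of the variables `o, …, o + n - 1`. -/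
def block {M : Type w} (n o : ℕ) (s : ℕ → M) : Fin n → M := fun j => s (o + j)

@[simp] lemma block_updN {M : Type w} {n : ℕ} (o : ℕ) (s : ℕ → M) (a : Fin n → M) :
    block n o (updN s o a) = a := funext fun j => updN_add s o a j

lemma block_updN_of_le {M : Type w} {n m o o' : ℕ} (h : o + n ≤ o') (s : ℕ → M)
    (a : Fin m → M) : block n o (updN s o' a) = block n o s :=
  funext fun j => updN_of_lt _ _ _ (by have := j.2; omega)

/-! ### Closure properties of definability in ESO(Q) -/

section EDef
variable {L L' : FirstOrder.Language.{u, v}} {k o n : ℕ} {Q : GenQuantifier.{w} k}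
  {P P' : StrPred.{u, v, w} L}

lemma EDef.congr (h : EDef Q o P)
    (hP : ∀ (M : Type w) [Nonempty M] 𝔐 s, P M 𝔐 s ↔ P' M 𝔐 s) : EDef Q o P' := by
  obtain ⟨ψ, hψ⟩ := h
  exact ⟨ψ, fun M _ 𝔐 s => (hψ M 𝔐 s).trans (hP M 𝔐 s)⟩

lemma EDef.and (h : EDef Q o P) (h' : EDef Q o P') :
    EDef Q o fun M 𝔐 s => P M 𝔐 s ∧ P' M 𝔐 s := by
  obtain ⟨ψ, hψ⟩ := h
  obtain ⟨ψ', hψ'⟩ := h'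
  exact ⟨ψ.and ψ', fun M _ 𝔐 s => and_congr (hψ M 𝔐 s) (hψ' M 𝔐 s)⟩

lemma EDef.or (h : EDef Q o P) (h' : EDef Q o P') :
    EDef Q o fun M 𝔐 s => P M 𝔐 s ∨ P' M 𝔐 s := by
  obtain ⟨ψ, hψ⟩ := h
  obtain ⟨ψ', hψ'⟩ := h'
  exact ⟨ψ.or ψ', fun M _ 𝔐 s => or_congr (hψ M 𝔐 s) (hψ' M 𝔐 s)⟩

lemma EDef.all (h : EDef Q (o + 1) P) :
    EDef Q o fun M 𝔐 s => ∀ a, P M 𝔐 (Function.update s o a) := by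
  unfold EDef at h
  rw [Finset.range_add_one] at h
  obtain ⟨ψ, hψ⟩ := h
  refine ⟨.all o ψ, fun M _ 𝔐 s => forall_congr' fun a => ?_⟩
  rw [res_update]
  exact hψ M 𝔐 _

lemma EDef.ex (h : EDef Q (o + 1) P) :
    EDef Q o fun M 𝔐 s => ∃ a, P M 𝔐 (Function.update s o a) := by
  unfold EDef at h
  rw [Finset.range_add_one] at h
  obtain ⟨ψ, hψ⟩ := h
  refine ⟨.ex o ψ, fun M _ 𝔐 s => exists_congr fun a => ?_⟩
  rw [res_update]
  exact hψ M 𝔐 _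

lemma EDef.allTuple (h : EDef Q (o + n) P) :
    EDef Q o fun M 𝔐 s => ∀ a : Fin n → M, P M 𝔐 (updN s o a) := by
  induction n generalizing P with
  | zero => exact h.congr fun M _ 𝔐 s => by simp [updN_zero]
  | succ n ih =>
    refine (ih (EDef.all h)).congr fun M _ 𝔐 s => ?_
    constructor
    · intro h a
      rw [updN_succ]
      exact h _ _
    · intro h a b
      have := h (Fin.snoc (α := fun _ => M) a b)
      rw [updN_succ] at this
      simpa using this

lemma EDef.exTuple (h : EDef Q (o + n) P) :
    EDef Q o fun M 𝔐 s => ∃ a : Fin n → M, P M 𝔐 (updN s o a) := by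
  induction n generalizing P with
  | zero => exact h.congr fun M _ 𝔐 s => by simp [updN_zero]
  | succ n ih =>
    refine (ih (EDef.ex h)).congr fun M _ 𝔐 s => ?_
    constructor
    · rintro ⟨a, b, h⟩
      refine ⟨Fin.snoc (α := fun _ => M) a b, ?_⟩
      rw [updN_succ]
      simpa using h
    · rintro ⟨a, h⟩
      rw [updN_succ] at h
      exact ⟨_, _, h⟩

lemma EDef.quant (h : EDef Q (o + k) P) :
    EDef Q o fun M 𝔐 s => {a | P M 𝔐 (updN s o a)} ∈ Q M := by
  let x : Fin k ↪ ℕ := ⟨fun j => o + j, fun i j h => by simpa [Fin.ext_iff] using h⟩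
  have hx : Finset.range (o + k) = Finset.range o ∪ Finset.univ.map x := by
    ext z
    simp only [Finset.mem_range, Finset.mem_union, Finset.mem_map, Finset.mem_univ, true_and]
    constructor
    · intro hz
      by_cases hzo : z < o
      · exact .inl hzo
      · exact .inr ⟨⟨z - o, by omega⟩, Nat.add_sub_cancel' (by omega)⟩
    · rintro (hz | ⟨j, rfl⟩)
      · omega
      · have := j.2
        change o + j < o + k
        omega
  unfold EDef at h
  rw [hx] at h
  obtain ⟨ψ, hψ⟩ := h
  refine ⟨.quant x ψ, fun M _ 𝔐 s => iff_of_eq (congrArg (· ∈ Q M) (Set.ext fun a => ?_))⟩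
  have := res_updateTuple (Finset.range o) x s (updN s o a) a (fun j => updN_add s o a j)
    fun z hz => updN_of_ne _ _ _ fun j hj => hz j hj.symm
  change ψ.Sat Q M 𝔐 _ ↔ _
  rw [this]
  exact hψ M 𝔐 _

lemma EDef.exRel {P : StrPred.{u, v, w} (L.sum (relVocab n))} (h : EDef Q o P) :
    EDef Q o fun M 𝔐 s => ∃ R : Set (Fin n → M),
      P M (@FirstOrder.Language.sumStructure L (relVocab n) M 𝔐 (relStructure R)) s := by
  obtain ⟨ψ, hψ⟩ := h
  exact ⟨.exRel n ψ, fun M _ 𝔐 s => exists_congr fun R => hψ M _ s⟩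

lemma EDef.eq {i j : ℕ} (hi : i < o) (hj : j < o) :
    EDef (L := L) Q o fun _ _ s => s i = s j :=
  ⟨.lit (.eq (varT (by simpa using hi)) (varT (by simpa using hj))), fun _ _ _ _ => Iff.rfl⟩

lemma EDef.neq {i j : ℕ} (hi : i < o) (hj : j < o) :
    EDef (L := L) Q o fun _ _ s => s i ≠ s j :=
  ⟨.lit (.neq (varT (by simpa using hi)) (varT (by simpa using hj))), fun _ _ _ _ => Iff.rfl⟩

lemma EDef.rel (R : L.Relations n) {z : Fin n → ℕ} (hz : ∀ j, z j < o) :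
    EDef (L := L) Q o fun _ 𝔐 s => 𝔐.RelMap R fun j => s (z j) :=
  ⟨.lit (.rel R fun j => varT (x := z j) (by simpa using hz j)), fun _ _ _ _ => Iff.rfl⟩

lemma EDef.nrel (R : L.Relations n) {z : Fin n → ℕ} (hz : ∀ j, z j < o) :
    EDef (L := L) Q o fun _ 𝔐 s => ¬ 𝔐.RelMap R fun j => s (z j) :=
  ⟨.lit (.nrel R fun j => varT (x := z j) (by simpa using hz j)), fun _ _ _ _ => Iff.rfl⟩

lemma EDef.rel_block (R : L.Relations n) (i : ℕ) (hi : i + n ≤ o) :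
    EDef (L := L) Q o fun _ 𝔐 s => 𝔐.RelMap R (block n i s) :=
  EDef.rel R fun j => by have := j.2; omega

lemma EDef.nrel_block (R : L.Relations n) (i : ℕ) (hi : i + n ≤ o) :
    EDef (L := L) Q o fun _ 𝔐 s => ¬ 𝔐.RelMap R (block n i s) :=
  EDef.nrel R fun j => by have := j.2; omega

lemma comp_append {M : Type w} {m n : ℕ} (s : ℕ → M) (i j : ℕ) (x : Fin (n + m)) :
    s (Fin.append (fun l : Fin n => i + (l : ℕ)) (fun l : Fin m => j + (l : ℕ)) x) =
      Fin.append (block n i s) (block m j s) x := by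
  induction x using Fin.addCases with
  | left l => simp [block]
  | right l => simp [block]

lemma append_lt {m n i j : ℕ} (hi : i + n ≤ o) (hj : j + m ≤ o) (x : Fin (n + m)) :
    Fin.append (fun l : Fin n => i + (l : ℕ)) (fun l : Fin m => j + (l : ℕ)) x < o := by
  induction x using Fin.addCases with
  | left l => rw [Fin.append_left]; omega
  | right l => rw [Fin.append_right]; omega

lemma EDef.rel_append {m i j : ℕ} (R : L.Relations (n + m)) (hi : i + n ≤ o) (hj : j + m ≤ o) :
    EDef (L := L) Q o fun _ 𝔐 s => 𝔐.RelMap R (Fin.append (block n i s) (block m j s)) :=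
  (EDef.rel R (append_lt hi hj)).congr fun M _ 𝔐 s => by simp only [comp_append]

lemma EDef.nrel_append {m i j : ℕ} (R : L.Relations (n + m)) (hi : i + n ≤ o)
    (hj : j + m ≤ o) :
    EDef (L := L) Q o fun _ 𝔐 s => ¬ 𝔐.RelMap R (Fin.append (block n i s) (block m j s)) :=
  (EDef.nrel R (append_lt hi hj)).congr fun M _ 𝔐 s => by simp only [comp_append]

/-- For `o = 0` no variable is available, so one has to be quantified. -/
lemma EDef.true : EDef (L := L) Q o fun _ _ _ => True :=
  (EDef.all (EDef.eq (i := o) (j := o) (by omega) (by omega))).congr fun M _ 𝔐 s => by simp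

lemma EDef.false : EDef (L := L) Q o fun _ _ _ => False :=
  (EDef.ex (EDef.neq (i := o) (j := o) (by omega) (by omega))).congr fun M _ 𝔐 s => by simp

lemma EDef.forall_mem {α : Type*} (l : List α) {P : α → StrPred.{u, v, w} L}
    (h : ∀ x, EDef Q o (P x)) : EDef Q o fun M 𝔐 s => ∀ x ∈ l, P x M 𝔐 s := by
  induction l with
  | nil => exact EDef.true.congr fun M _ 𝔐 s => by simp
  | cons x l ih => exact ((h x).and ih).congr fun M _ 𝔐 s => by simp

lemma EDef.exists_mem {α : Type*} (l : List α) {P : α → StrPred.{u, v, w} L}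
    (h : ∀ x, EDef Q o (P x)) : EDef Q o fun M 𝔐 s => ∃ x ∈ l, P x M 𝔐 s := by
  induction l with
  | nil => exact EDef.false.congr fun M _ 𝔐 s => by simp
  | cons x l ih => exact ((h x).or ih).congr fun M _ 𝔐 s => by simp

lemma EDef.literal {V : Finset ℕ} (l : Literal L V) (ι : L.LHom L') {ρ : {x : ℕ // x ∈ V} → ℕ}
    (hρ : ∀ x, ρ x < o) :
    EDef (L := L') Q o fun M _ s => @Literal.Sat L V M (ι.reduct M) (fun x => s (ρ x)) l := by
  let T : L.Term {x : ℕ // x ∈ V} → L'.Term {x : ℕ // x ∈ Finset.range o} := fun t =>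
    ι.onTerm (t.relabel fun x => ⟨ρ x, by simpa using hρ x⟩)
  have hT : ∀ (M : Type w) (_ : L'.Structure M) (s : ℕ → M) t,
      (T t).realize (res _ s) = @FirstOrder.Language.Term.realize L M (ι.reduct M) _
        (fun x => s (ρ x)) t := by
    intro M 𝔐 s t
    let := ι.reduct M
    rw [FirstOrder.Language.LHom.realize_onTerm, FirstOrder.Language.Term.realize_relabel]
    rfl
  cases l with
  | eq t₁ t₂ =>
    refine ⟨.lit (.eq (T t₁) (T t₂)), fun M _ 𝔐 s => ?_⟩
    simp only [ESOFormula.Sat, Literal.Sat, hT]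
  | neq t₁ t₂ =>
    refine ⟨.lit (.neq (T t₁) (T t₂)), fun M _ 𝔐 s => ?_⟩
    simp only [ESOFormula.Sat, Literal.Sat, hT]
  | rel R ts =>
    refine ⟨.lit (.rel (ι.onRelation R) fun j => T (ts j)), fun M _ 𝔐 s => ?_⟩
    simp only [ESOFormula.Sat, Literal.Sat, hT]
    rfl
  | nrel R ts =>
    refine ⟨.lit (.nrel (ι.onRelation R) fun j => T (ts j)), fun M _ 𝔐 s => ?_⟩
    simp only [ESOFormula.Sat, Literal.Sat, hT]
    rfl

end EDef

/-- The team coded by a relation along an enumeration of the variables. -/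
def relTeam {M : Type w} {V : Finset ℕ} {n : ℕ} (e : Fin n ≃ {x : ℕ // x ∈ V})
    (R : (Fin n → M) → Prop) : Team V M := {r | R fun j => r (e j)}

/-! ### Teams coded by relations -/

section relTeam
variable {M : Type w} {V : Finset ℕ} {n : ℕ} (e : Fin n ≃ {x : ℕ // x ∈ V})
  {R : (Fin n → M) → Prop}

lemma forall_relTeam {B : Assignment V M → Prop} :
    (∀ r ∈ relTeam e R, B r) ↔ ∀ a, ¬ R a ∨ B fun x => a (e.symm x) := by
  constructor
  · intro h a
    by_cases ha : R a
    · exact .inr (h _ (by simpa [relTeam] using ha))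
    · exact .inl ha
  · intro h r hr
    have := (h fun j => r (e j)).resolve_left (not_not.2 hr)
    simpa using this

lemma exists_relTeam {B : Assignment V M → Prop} :
    (∃ r ∈ relTeam e R, B r) ↔ ∃ a, R a ∧ B fun x => a (e.symm x) := by
  constructor
  · rintro ⟨r, hr, h⟩
    exact ⟨_, hr, by simpa using h⟩
  · rintro ⟨a, ha, h⟩
    exact ⟨_, by simpa [relTeam] using ha, h⟩

lemma exists_eq_relTeam (X : Team V M) : ∃ R : Set (Fin n → M), X = relTeam e (· ∈ R) :=
  ⟨{a | (fun x => a (e.symm x)) ∈ X}, by ext r; simp [relTeam]⟩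

/-- The positions of the values of an extended assignment. -/
def extPos {V' : Finset ℕ} {n' m : ℕ} (e' : Fin n' ≃ {x : ℕ // x ∈ V'})
    (σ : {x : ℕ // x ∈ V'} → {x : ℕ // x ∈ V} ⊕ Fin m) (j : Fin n') : Fin (n + m) :=
  Sum.elim (fun x => Fin.castAdd m (e.symm x)) (Fin.natAdd n) (σ (e' j))

lemma append_extPos {V' : Finset ℕ} {n' m : ℕ} (e' : Fin n' ≃ {x : ℕ // x ∈ V'})
    (σ : {x : ℕ // x ∈ V'} → {x : ℕ // x ∈ V} ⊕ Fin m) (a : Fin n → M) (b : Fin m → M)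
    (j : Fin n') : Fin.append a b (extPos e e' σ j) =
      Sum.elim (fun x => a (e.symm x)) b (σ (e' j)) := by
  unfold extPos
  rcases σ (e' j) with x | i
  · exact Fin.append_left a b _
  · exact Fin.append_right a b _

/-- The choice function `F` is replaced by the relation `S` of concatenations of an old row with a
chosen tuple, and `T` codes the extended team. The map `σ` tells which variables keep an old value
and which receive a new one. The clauses say that the sections of `S` over the team lie in `C`, that
`T` contains every extended row, and that it contains nothing else. Implications appear as
disjunctions because formulas are in negation normal form. -/
lemma exists_extension_iff {V' : Finset ℕ} {n' m : ℕ} (e' : Fin n' ≃ {x : ℕ // x ∈ V'})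
    (σ : {x : ℕ // x ∈ V'} → {x : ℕ // x ∈ V} ⊕ Fin m) (C : Set (Set (Fin m → M)))
    (B : Team V' M → Prop) :
    (∃ F : relTeam e R → Set (Fin m → M), (∀ s, F s ∈ C) ∧
      B {s' | ∃ s : relTeam e R, ∃ a ∈ F s, s' = fun z => Sum.elim s.1 a (σ z)}) ↔
    ∃ (S : Set (Fin (n + m) → M)) (T : Set (Fin n' → M)),
      (∀ a, ¬ R a ∨ {b | Fin.append a b ∈ S} ∈ C) ∧
      (∀ c, ¬ R (fun j => c (Fin.castAdd m j)) ∨ c ∉ S ∨ (fun j => c (extPos e e' σ j)) ∈ T) ∧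
      (∀ t, t ∉ T ∨ ∃ c, R (fun j => c (Fin.castAdd m j)) ∧ c ∈ S ∧
        ∀ j, t j = c (extPos e e' σ j)) ∧
      B (relTeam e' (· ∈ T)) := by
  have happ : ∀ c : Fin (n + m) → M,
      Fin.append (fun j => c (Fin.castAdd m j)) (fun j => c (Fin.natAdd n j)) = c :=
    fun c => Fin.append_castAdd_natAdd
  constructor
  · rintro ⟨F, hF, hB⟩
    obtain ⟨T, hT⟩ := exists_eq_relTeam e'
      {s' | ∃ s : relTeam e R, ∃ a ∈ F s, s' = fun z => Sum.elim s.1 a (σ z)}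
    rw [hT] at hB
    let S : Set (Fin (n + m) → M) := {c | ∃ r : relTeam e R,
      (fun j => r.1 (e j)) = (fun j => c (Fin.castAdd m j)) ∧ (fun j => c (Fin.natAdd n j)) ∈ F r}
    refine ⟨S, T, fun a => ?_, fun c => ?_, fun t => ?_, hB⟩
    · by_cases ha : R a
      · right
        have hr : (fun x => a (e.symm x)) ∈ relTeam e R := by simpa [relTeam] using ha
        convert hF ⟨_, hr⟩
        ext b
        constructor
        · rintro ⟨r, hra, hrb⟩
          simp only [Fin.append_left, Fin.append_right] at hra hrb
          have hreq : (⟨_, hr⟩ : relTeam e R) = r := Subtype.ext (funext fun x => by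
            simpa using (congrFun hra (e.symm x)).symm)
          rwa [hreq]
        · intro hb
          refine ⟨⟨_, hr⟩, ?_, ?_⟩
          · simp
          · simpa using hb
      · exact .inl ha
    · refine or_iff_not_imp_left.2 fun _ => or_iff_not_imp_left.2 fun hc => ?_
      obtain ⟨r, hra, hrb⟩ := not_not.1 hc
      have : (fun z => Sum.elim r.1 (fun j => c (Fin.natAdd n j)) (σ z)) ∈
          relTeam e' (· ∈ T) := hT ▸ ⟨r, _, hrb, rfl⟩
      refine (iff_of_eq (congrArg (· ∈ T) (funext fun j => ?_))).2 this
      have hrc : ∀ x, c (Fin.castAdd m (e.symm x)) = r.1 x := fun x => by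
        simpa using (congrFun hra (e.symm x)).symm
      conv_lhs => rw [← happ c, append_extPos]
      simp only [hrc]
    · refine or_iff_not_imp_left.2 fun ht => ?_
      have ht' : (fun z => t (e'.symm z)) ∈ relTeam e' (· ∈ T) := by
        simpa [relTeam] using ht
      rw [← hT] at ht'
      obtain ⟨r, b, hb, hrb⟩ := ht'
      refine ⟨Fin.append (fun j => r.1 (e j)) b, ?_, ⟨r, ?_, ?_⟩, fun j => ?_⟩
      · simp only [Fin.append_left]
        exact r.2
      · simp
      · simpa using hb
      · rw [append_extPos]
        simpa using congrFun hrb (e' j)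
  · rintro ⟨S, T, h1, h2, h3, hB⟩
    refine ⟨fun r => {b | Fin.append (fun j => r.1 (e j)) b ∈ S},
      fun r => (h1 _).resolve_left (not_not.2 r.2), ?_⟩
    convert hB
    ext r'
    constructor
    · rintro ⟨r, b, hb, rfl⟩
      have := ((h2 (Fin.append (fun j => r.1 (e j)) b)).resolve_left
        (not_not.2 (by simp only [Fin.append_left]; exact r.2))).resolve_left (not_not.2 hb)
      simpa [append_extPos, relTeam] using this
    · intro hr'
      obtain ⟨c, hc, hcS, hj⟩ := (h3 _).resolve_left (not_not.2 hr')
      refine ⟨⟨fun x => c (Fin.castAdd m (e.symm x)), by simpa [relTeam] using hc⟩,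
        fun j => c (Fin.natAdd n j), ?_, ?_⟩
      · simpa [happ] using hcS
      · funext z
        obtain ⟨j, rfl⟩ := e'.surjective z
        rw [hj j]
        conv_lhs => rw [← happ c, append_extPos]

end relTeam

/-! ### The translation of I(Q) -/

section
variable {L : FirstOrder.Language.{u, v}} {k : ℕ} {Q : GenQuantifier.{w} k}

/-- Satisfaction of `φ` by the team coded by a relation symbol is expressible in `ESO(Q)`. -/
def TeamDef (Q : GenQuantifier.{w} k) {V : Finset ℕ} (φ : IFormula L k V) : Prop :=
  ∀ (L' : FirstOrder.Language.{u, v}) (ι : L.LHom L') (n : ℕ) (R : L'.Relations n)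
    (e : Fin n ≃ {x : ℕ // x ∈ V}) (o : ℕ), EDef Q o fun M 𝔐 _ =>
      @IFormula.Sat L k Q M (ι.reduct M) V φ (relTeam e fun a => 𝔐.RelMap R a)

/-- Quantification of first-order variables. -/
lemma TeamDef.quantLike {V V' : Finset ℕ} {m : ℕ} {φ : IFormula L k V'} {ψ : IFormula L k V}
    (C : (M : Type w) → Set (Set (Fin m → M)))
    (hC : ∀ (L' : FirstOrder.Language.{u, v}) (n : ℕ) (S : L'.Relations (n + m)) (i o : ℕ),
      i + n ≤ o → EDef Q o fun M 𝔐 s => {a | 𝔐.RelMap S (Fin.append (block n i s) a)} ∈ C M)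
    (σ : {x : ℕ // x ∈ V'} → {x : ℕ // x ∈ V} ⊕ Fin m)
    (hψ : ∀ (M : Type w) (_ : L.Structure M) (X : Team V M), ψ.Sat Q M X ↔
      ∃ F : X → Set (Fin m → M), (∀ s, F s ∈ C M) ∧
        φ.Sat Q M {s' | ∃ s : X, ∃ a ∈ F s, s' = fun z => Sum.elim s.1 a (σ z)})
    (h : TeamDef Q φ) : TeamDef Q ψ := by
  intro L' ι n R e o
  let n' := Fintype.card {x : ℕ // x ∈ V'}
  let e' : Fin n' ≃ {x : ℕ // x ∈ V'} := (Fintype.equivFin _).symm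
  -- The two added symbols stand for `S` and `T` of `exists_extension_iff`; `h1`, `h2` and `h3`
  -- express its three clauses.
  let LS := L'.sum (relVocab (n + m))
  let LT := LS.sum (relVocab n')
  let ιT : L.LHom LT :=
    FirstOrder.Language.LHom.sumInl.comp (FirstOrder.Language.LHom.sumInl.comp ι)
  let RT : LT.Relations n := .inl (.inl R)
  let ST : LT.Relations (n + m) := .inl (.inr .mk)
  let T : LT.Relations n' := .inr .mk
  let τ := extPos (m := m) e e' σ
  have h1 : EDef Q o fun M (𝔐 : LT.Structure M) _ => ∀ a : Fin n → M, ¬ 𝔐.RelMap RT a ∨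
      {b | 𝔐.RelMap ST (Fin.append a b)} ∈ C M :=
    ((EDef.nrel_block RT o le_rfl).or (hC LT n ST o (o + n) le_rfl)).allTuple.congr
      fun M _ 𝔐 s => by simp only [block_updN]
  have h2 : EDef Q o fun M (𝔐 : LT.Structure M) _ => ∀ c : Fin (n + m) → M,
      ¬ 𝔐.RelMap RT (fun j => c (Fin.castAdd m j)) ∨ ¬ 𝔐.RelMap ST c ∨
        𝔐.RelMap T fun j => c (τ j) := by
    have h2a : EDef Q (o + (n + m)) fun M (𝔐 : LT.Structure M) s =>
        ¬ 𝔐.RelMap RT fun j => block (n + m) o s (Fin.castAdd m j) :=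
      EDef.nrel RT (z := fun j => o + Fin.castAdd m j) fun j => by omega
    have h2b : EDef Q (o + (n + m)) fun M (𝔐 : LT.Structure M) s =>
        𝔐.RelMap T fun j => block (n + m) o s (τ j) :=
      EDef.rel T (z := fun j => o + τ j) fun j => by omega
    exact (h2a.or ((EDef.nrel_block ST o le_rfl).or h2b)).allTuple.congr
      fun M _ 𝔐 s => by simp only [block_updN]
  have h3 : EDef Q o fun M (𝔐 : LT.Structure M) _ => ∀ t : Fin n' → M, ¬ 𝔐.RelMap T t ∨
      ∃ c : Fin (n + m) → M, 𝔐.RelMap RT (fun j => c (Fin.castAdd m j)) ∧ 𝔐.RelMap ST c ∧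
        ∀ j ∈ List.finRange n', t j = c (τ j) := by
    have h3a : EDef Q (o + n' + (n + m)) fun M (𝔐 : LT.Structure M) s =>
        𝔐.RelMap RT fun j => block (n + m) (o + n') s (Fin.castAdd m j) :=
      EDef.rel RT (z := fun j => o + n' + Fin.castAdd m j) fun j => by omega
    have h3b : ∀ j : Fin n', EDef Q (o + n' + (n + m)) fun M (_ : LT.Structure M) s =>
        block n' o s j = block (n + m) (o + n') s (τ j) := fun j =>
      EDef.eq (i := o + j) (j := o + n' + τ j) (by omega) (by omega)
    exact ((EDef.nrel_block T o le_rfl).or (h3a.and ((EDef.rel_block ST (o + n') le_rfl).and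
      (EDef.forall_mem (List.finRange n') h3b))).exTuple).allTuple.congr
      fun M _ 𝔐 s => by simp only [block_updN, block_updN_of_le (le_refl (o + n'))]
  refine (EDef.exRel (EDef.exRel (h1.and (h2.and (h3.and (h LT ιT n' T e' o)))))).congr
    fun M _ 𝔐 s => ?_
  rw [hψ M (ι.reduct M), exists_extension_iff e e' σ]
  refine exists_congr fun S => exists_congr fun T => and_congr Iff.rfl (and_congr Iff.rfl
    (and_congr ?_ Iff.rfl))
  simp only [List.mem_finRange, true_imp_iff]
  rfl

/-- Satisfaction of a formula of `I(Q)` by a team is expressible in `ESO(Q)`. -/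
theorem IFormula.teamDef {V : Finset ℕ} (φ : IFormula L k V) : TeamDef Q φ := by
  induction φ with
  | @lit V l =>
    intro L' ι n R e o
    refine ((EDef.nrel_block R o le_rfl).or (EDef.literal l ι (ρ := fun x => o + e.symm x)
      fun x => by omega)).allTuple.congr fun M _ 𝔐 s => ?_
    simp only [IFormula.Sat, forall_relTeam, updN_add, block_updN]
  | @indep V y x z =>
    intro L' ι n R e o
    -- The blocks at `o`, `o + n` and `o + n + n` hold the assignments `s`, `s'` and `s₀` of the
    -- independence atom.
    have heq : ∀ (l : List {x : ℕ // x ∈ V}) (i j : ℕ), i + n ≤ o + n + n + n →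
        j + n ≤ o + n + n + n → EDef (L := L') Q (o + n + n + n) fun M _ s =>
          ∀ v ∈ l, block n i s (e.symm v) = block n j s (e.symm v) := fun l i j hi hj =>
      EDef.forall_mem l fun v => EDef.eq (i := i + e.symm v) (j := j + e.symm v)
        (by omega) (by omega)
    have hne : EDef (L := L') Q (o + n + n) fun M _ s =>
          ∃ v ∈ x, block n o s (e.symm v) ≠ block n (o + n) s (e.symm v) :=
      EDef.exists_mem x fun v => EDef.neq (i := o + e.symm v) (j := o + n + e.symm v)
        (by omega) (by omega)
    refine (((EDef.nrel_block R o (by omega)).or ((EDef.nrel_block R (o + n) (by omega)).or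
      (hne.or (((EDef.rel_block R (o + n + n) le_rfl).and
        ((heq x (o + n + n) o (by omega) (by omega)).and
        ((heq y (o + n + n) o (by omega) (by omega)).and
        (heq z (o + n + n) (o + n) (by omega) (by omega))))).exTuple)))).allTuple.allTuple).congr
      fun M _ 𝔐 s => ?_
    simp only [IFormula.Sat, forall_relTeam, exists_relTeam, List.map_inj_left, block_updN,
      block_updN_of_le (le_refl (o + n)), block_updN_of_le (le_refl (o + n + n)),
      block_updN_of_le (show o + n ≤ o + n + n by omega)]
    refine forall_congr' fun a => ⟨fun h => ?_, fun h a' => ?_⟩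
    · refine or_iff_not_imp_left.2 fun ha a' => ?_
      refine or_iff_not_imp_left.2 fun ha' hx => ?_
      refine (((h a').resolve_left ha).resolve_left ha').resolve_left ?_
      rintro ⟨v, hv, hne⟩
      exact hne (hx v hv)
    · refine or_iff_not_imp_left.2 fun ha => or_iff_not_imp_left.2 fun ha' =>
        or_iff_not_imp_left.2 fun hx => ?_
      push Not at hx
      exact ((h.resolve_left ha) a').resolve_left ha' hx
  | @nindep V y x z =>
    intro L' ι n R e o
    refine (EDef.nrel_block R o le_rfl).allTuple.congr fun M _ 𝔐 s => ?_
    have := forall_relTeam e (R := fun a => 𝔐.RelMap R a) (B := fun _ => False)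
    simp only [or_false] at this
    simp only [IFormula.Sat, block_updN, ← this, Set.eq_empty_iff_forall_notMem]
  | and φ ψ ihφ ihψ =>
    intro L' ι n R e o
    exact (ihφ L' ι n R e o).and (ihψ L' ι n R e o)
  | @or V φ ψ ihφ ihψ =>
    intro L' ι n R e o
    let L₁ := L'.sum (relVocab n)
    let L₂ := L₁.sum (relVocab n)
    let ι₂ : L.LHom L₂ :=
      FirstOrder.Language.LHom.sumInl.comp (FirstOrder.Language.LHom.sumInl.comp ι)
    let R₀ : L₂.Relations n := .inl (.inl R)
    let R₁ : L₂.Relations n := .inl (.inr .mk)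
    let R₂ : L₂.Relations n := .inr .mk
    have h : ∀ S : L₂.Relations n, EDef Q (o + n) fun M 𝔐 s => 𝔐.RelMap S (block n o s) :=
      fun S => EDef.rel_block S o le_rfl
    have h' : ∀ S : L₂.Relations n, EDef Q (o + n) fun M 𝔐 s => ¬ 𝔐.RelMap S (block n o s) :=
      fun S => EDef.nrel_block S o le_rfl
    refine (EDef.exRel (EDef.exRel ((((h' R₀).or ((h R₁).or (h R₂))).and
      (((h' R₁).or (h R₀)).and ((h' R₂).or (h R₀)))).allTuple.and
      ((ihφ L₂ ι₂ n R₁ e o).and (ihψ L₂ ι₂ n R₂ e o))))).congr fun M _ 𝔐 s => ?_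
    simp only [block_updN]
    constructor
    · rintro ⟨Y, Z, hX, hY, hZ⟩
      refine ⟨relTeam e (· ∈ Y), relTeam e (· ∈ Z), ?_, hY, hZ⟩
      ext r
      obtain ⟨h1, h2, h3⟩ := hX fun j => r (e j)
      constructor
      · intro hr
        exact h1.resolve_left (not_not.2 hr)
      · rintro (hr | hr)
        · exact h2.resolve_left (not_not.2 hr)
        · exact h3.resolve_left (not_not.2 hr)
    · rintro ⟨Y, Z, hX, hY, hZ⟩
      obtain ⟨Y, rfl⟩ := exists_eq_relTeam e Y
      obtain ⟨Z, rfl⟩ := exists_eq_relTeam e Z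
      refine ⟨Y, Z, fun a => ?_, hY, hZ⟩
      have ha : 𝔐.RelMap R a ↔ a ∈ Y ∨ a ∈ Z := by
        have := Set.ext_iff.1 hX fun x => a (e.symm x)
        simpa [relTeam] using this
      change (¬ 𝔐.RelMap R a ∨ a ∈ Y ∨ a ∈ Z) ∧ (a ∉ Y ∨ 𝔐.RelMap R a) ∧
        (a ∉ Z ∨ 𝔐.RelMap R a)
      tauto
  | @ex V y φ ih =>
    -- That a section is a singleton is first-order: some `a` belongs to it, and every `b` in it
    -- equals `a`.
    refine TeamDef.quantLike (m := 1) (fun M => {A | ∃ a, A = {a}}) ?_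
      (fun z => if h : z.1 = y then .inr 0
        else .inl ⟨z.1, Finset.mem_of_mem_insert_of_ne z.2 h⟩) ?_ ih
    · intro L' n S i o hi
      have heq : EDef (L := L') Q (o + 1 + 1) fun M _ s => block 1 (o + 1) s 0 = block 1 o s 0 :=
        EDef.eq (i := o + 1) (j := o) (by omega) (by omega)
      refine ((EDef.rel_append (i := i) S (by omega) (le_refl (o + 1))).and
        ((EDef.nrel_append (i := i) S (by omega) (le_refl (o + 1 + 1))).or heq).allTuple).exTuple.congr
        fun M _ 𝔐 s => ?_
      simp only [block_updN_of_le hi, block_updN_of_le (show i + n ≤ o + 1 by omega),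
        block_updN_of_le (le_refl (o + 1)), block_updN]
      refine exists_congr fun a => ?_
      rw [Set.eq_singleton_iff_unique_mem]
      refine and_congr Iff.rfl (forall_congr' fun b => ?_)
      rw [← imp_iff_not_or]
      exact imp_congr Iff.rfl ⟨fun h => funext fun j => by rwa [Fin.fin_one_eq_zero j],
        fun h => congrFun h 0⟩
    · intro M _ X
      have hu : ∀ (s : Assignment V M) (a : Fin 1 → M), s.update y (a 0) =
          fun z => Sum.elim s a (if h : z.1 = y then .inr 0
            else .inl ⟨z.1, Finset.mem_of_mem_insert_of_ne z.2 h⟩) := by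
        intro s a
        funext z
        by_cases h : z.1 = y <;> simp [Assignment.update, h]
      simp only [← hu]
      constructor
      · rintro ⟨f, hf⟩
        exact ⟨fun s => {fun _ => f s}, fun s => ⟨_, rfl⟩, by simpa using hf⟩
      · rintro ⟨F, hF, h⟩
        choose a ha using hF
        exact ⟨fun s => a s 0, by simpa [ha] using h⟩
  | @all V y φ ih =>
    refine TeamDef.quantLike (m := 1) (fun M => {Set.univ}) ?_
      (fun z => if h : z.1 = y then .inr 0
        else .inl ⟨z.1, Finset.mem_of_mem_insert_of_ne z.2 h⟩) ?_ ih
    · intro L' n S i o hi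
      refine (EDef.rel_append (i := i) S (by omega) (le_refl (o + 1))).allTuple.congr fun M _ 𝔐 s => ?_
      simp only [block_updN_of_le hi, block_updN]
      exact Set.eq_univ_iff_forall.symm
    · intro M _ X
      have hu : ∀ (s : Assignment V M) (a : Fin 1 → M), s.update y (a 0) =
          fun z => Sum.elim s a (if h : z.1 = y then .inr 0
            else .inl ⟨z.1, Finset.mem_of_mem_insert_of_ne z.2 h⟩) := by
        intro s a
        funext z
        by_cases h : z.1 = y <;> simp [Assignment.update, h]
      simp only [← hu]
      have : {s' | ∃ s ∈ X, ∃ a : M, s' = s.update y a} =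
          {s' | ∃ s : X, ∃ a ∈ (Set.univ : Set (Fin 1 → M)), s' = s.1.update y (a 0)} := by
        ext s'
        constructor
        · rintro ⟨s, hs, a, rfl⟩
          exact ⟨⟨s, hs⟩, fun _ => a, trivial, rfl⟩
        · rintro ⟨s, a, -, rfl⟩
          exact ⟨s, s.2, a 0, rfl⟩
      simp only [IFormula.Sat, this]
      constructor
      · exact fun h => ⟨fun _ => Set.univ, fun _ => rfl, h⟩
      · rintro ⟨F, hF, h⟩
        obtain rfl : F = fun _ => Set.univ := funext hF
        exact h
  | @quant V x φ ih =>
    refine TeamDef.quantLike (m := k) (fun M => Q M) ?_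
      (fun z => if h : ∃ i, x i = z.1 then .inr h.choose
        else .inl ⟨z.1, (Finset.mem_union.mp z.2).resolve_right fun hz => h (by simpa using hz)⟩)
      ?_ ih
    · intro L' n S i o hi
      refine (EDef.rel_append (i := i) S (by omega) (le_refl (o + k))).quant.congr fun M _ 𝔐 s => ?_
      simp only [block_updN_of_le hi, block_updN]
    · intro M _ X
      have hu : ∀ (s : Assignment V M) (a : Fin k → M), s.updateTuple x a =
          fun z => Sum.elim s a (if h : ∃ i, x i = z.1 then .inr h.choose
            else .inl ⟨z.1, (Finset.mem_union.mp z.2).resolve_right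
              fun hz => h (by simpa using hz)⟩) := by
        intro s a
        funext z
        by_cases h : ∃ i, x i = z.1 <;> simp [Assignment.updateTuple, h]
      simp only [← hu]
      rfl

/-- The team of the empty assignment is coded by the true nullary relation, which is introduced by
`∃R` and fixed by the conjunct `R`. -/
theorem exists_esoSentence (φ : ISentence L k) : ∃ ψ : ESOSentence L k,
    ∀ (M : Type w) [Nonempty M] [L.Structure M],
      ISentence.True Q M φ ↔ ESOSentence.True Q M ψ := by
  let L' := L.sum (relVocab 0)
  let R : L'.Relations 0 := .inr .mk
  let e : Fin 0 ≃ {x : ℕ // x ∈ (∅ : Finset ℕ)} := Equiv.equivOfIsEmpty _ _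
  obtain ⟨ψ, hψ⟩ := EDef.exRel ((EDef.rel_block R 0 le_rfl).and
    (IFormula.teamDef (Q := Q) φ L' FirstOrder.Language.LHom.sumInl 0 R e 0))
  refine ⟨ψ, fun M _ 𝔐 => ?_⟩
  have h := hψ M 𝔐 fun _ => Classical.arbitrary M
  have hs : (res (Finset.range 0) fun _ => Classical.arbitrary M) =
      fun x => absurd x.2 (Finset.notMem_empty x.1) := funext fun x => absurd x.2 (by simp)
  rw [hs] at h
  refine Iff.trans ?_ h.symm
  have hR : ∀ R : Set (Fin 0 → M), (∃ a, a ∈ R) → relTeam e (· ∈ R) =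
      {fun x : {x // x ∈ (∅ : Finset ℕ)} => absurd x.2 (Finset.notMem_empty x.1)} := by
    rintro R ⟨a, ha⟩
    ext r
    constructor
    · exact fun _ => funext fun x => absurd x.2 (Finset.notMem_empty _)
    · intro _
      change _ ∈ R
      rwa [Subsingleton.elim (fun j => r (e j)) a]
  constructor
  · intro hφ
    refine ⟨Set.univ, trivial, ?_⟩
    have := hR Set.univ ⟨fun j => j.elim0, trivial⟩
    change IFormula.Sat Q M φ (relTeam e (· ∈ Set.univ))
    rw [this]
    exact hφ
  · rintro ⟨R, hR', hφ⟩
    change IFormula.Sat Q M φ (relTeam e (· ∈ R)) at hφ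
    rw [hR R ⟨_, hR'⟩] at hφ
    exact hφ

end

end TeamLogic

theorem mainTheorem2 {k : ℕ} (Q : TeamLogic.GenQuantifier.{w} k)
    (hmono : Q.Monotone) (hnontriv : Q.NonTrivial) (L : FirstOrder.Language.{u, v}) :
    (∀ φ : TeamLogic.ISentence L k, ∃ ψ : TeamLogic.ESOSentence L k,
      ∀ (M : Type w) [Nonempty M] [L.Structure M],
        TeamLogic.ISentence.True Q M φ ↔ TeamLogic.ESOSentence.True Q M ψ) ∧
    (∀ ψ : TeamLogic.ESOSentence L k, ∃ φ : TeamLogic.ISentence L k,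
      ∀ (M : Type w) [Nonempty M] [L.Structure M],
        TeamLogic.ISentence.True Q M φ ↔ TeamLogic.ESOSentence.True Q M ψ) := by
  exact ⟨fun φ => TeamLogic.exists_esoSentence φ,
    fun ψ => TeamLogic.exists_isentence hmono hnontriv ψ⟩
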